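/- **Theorem (Bożejko–Fendler).** Let $G$ be a locally compact (Hausdorff) group with a left Haar measure, let $\lambda$ be its left regular representation on $L^2(G)$, $(\lambda(x)f)(y)=f(x^{-1}y)$, and let $\mathfrak M(G)=\lambda(G)''$ be the group von Neumann algebra. The Fourier algebra $A(G)$ is the predual of $\mathfrak M(G)$, realised as the space of the functions $x\mapsto\omega(\lambda(x))$ on $G$, where $\omega$ runs through the $\sigma$-weakly continuous linear functionals on $\mathfrak M(G)$. A continuous function $\phi\colon G\to\mathbb C$ belongs to $M_0A(G)$ if $\phi\psi\in A(G)$ for every $\psi\in A(G)$ and the transposed operator $m_\phi^*\colon\mathfrak M(G)\to\mathfrak M(G)$ of $m_\phi\colon A(G)\to A(G)$, $m_\phi\psi=\phi\psi$, is completely bounded; then $\|\phi\|_{M_0A(G)}$ is the completely bounded norm of $m_\phi^*$. For $a\in M_n(\mathbb C)$ let $\|a\|_S=\sup\{\|a*b\| : b\in M_n(\mathbb C),\ \|b\|\le 1\}$, where $a*b=(a_{ij}b_{ij})$ and $\|\cdot\|$ is the operator norm on $\mathbb C^n$ with its Euclidean norm. A family $(f_i)_{i\in I}$ of complex functions on $G$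 is called locally countable if every point of $G$ has a neighbourhood on which all but countably many of the $f_i$ vanish identically. Inner products are linear in the first variable. Let $\phi\colon G\to\mathbb C$ be continuous and let $k\ge 0$. Then the following conditions are equivalent. 1. $\phi\in M_0A(G)$ and $\|\phi\|_{M_0A(G)}\le k$. 2. For every finite set $\{x_1,\dots,x_n\}$ of (distinct) elements of $G$, $\bigl\|\bigl(\phi(x_j^{-1}x_i)\bigr)_{i,j=1}^n\bigr\|_S\le k$. 3. There exist a complex Hilbert space $H$ and two bounded maps $\xi,\eta\colon G\to H$ such that $\phi(y^{-1}x)=\langle\xi(x),\eta(y)\rangle$ for all $x,y\in G$ and $\bigl(\sup_{x\in G}\|\xi(x)\|\bigr)\bigl(\sup_{y\in G}\|\eta(y)\|\bigr)\le k$. 4. There exist a complex Hilbert space $H$ and two bounded maps $\xi,\eta\colon G\to H$ as in (3) with the additional property that, for every orthonormal basis $(e_i)_{i\in I}$ of $H$, the coordinate functions $\xi_i=\langle\xi(\cdot),e_i\rangle$ and $\eta_i=\langle\eta(\cdot),e_i\rangle$ are continuous and the families $(\xi_i)_{i\in I}$ and $(\eta_i)_{i\in I}$ are locally countable. -/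

import Mathlib

universe u v

open MeasureTheory Topology
open scoped ENNReal InnerProductSpace

namespace HerzSchur

noncomputable section

/-! ### Schur multipliers of matrices -/

/-- The Schur multiplier norm of a complex matrix `a`: the supremum of the operator norms
`‖a * b‖` of the entrywise products of `a` with the matrices `b` of operator norm `≤ 1`, where
matrices act on the Euclidean space `ℂⁿ`. -/
def schurNorm {n : ℕ} (a : Matrix (Fin n) (Fin n) ℂ) : ℝ≥0∞ :=
  ⨆ (b : Matrix (Fin n) (Fin n) ℂ) (_ : ‖Matrix.toEuclideanCLM (𝕜 := ℂ) b‖ ≤ 1),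
    ‖Matrix.toEuclideanCLM (𝕜 := ℂ) (a.hadamard b)‖ₑ

/-! ### Matrices over operator algebras and completely bounded maps -/

section Operators

variable {H : Type*} [NormedAddCommGroup H] [InnerProductSpace ℂ H]

/-- The operator on the Hilbert space `Hⁿ = H ⊕ ⋯ ⊕ H` given by an `n × n` matrix of bounded
operators on `H`. -/
def matrixOperator {n : ℕ} (a : Matrix (Fin n) (Fin n) (H →L[ℂ] H)) :
    PiLp 2 (fun _ : Fin n => H) →L[ℂ] PiLp 2 (fun _ : Fin n => H) :=
  ((PiLp.continuousLinearEquiv 2 ℂ (fun _ : Fin n => H)).symm :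
      (Fin n → H) →L[ℂ] PiLp 2 (fun _ : Fin n => H)) ∘L
    ContinuousLinearMap.pi
      (fun i => ∑ j, a i j ∘L PiLp.proj (𝕜 := ℂ) 2 (fun _ : Fin n => H) j)

theorem matrixOperator_apply {n : ℕ} (a : Matrix (Fin n) (Fin n) (H →L[ℂ] H))
    (v : PiLp 2 (fun _ : Fin n => H)) (i : Fin n) :
    matrixOperator a v i = ∑ j, a i j (v j) := by
  simp [matrixOperator]

variable [CompleteSpace H]

/-- The completely bounded norm of a linear map `Φ : M → M` on a von Neumann algebra `M` of
operators on `H`: the supremum over `n` of the norms of the maps `[a i j] ↦ [Φ (a i j)]` on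
`M_n(M)`, where `M_n(M)` carries the operator norm on `Hⁿ`. It is `∞` if `Φ` is not completely
bounded. -/
def cbNorm (M : VonNeumannAlgebra H) (Φ : M.toStarSubalgebra →ₗ[ℂ] M.toStarSubalgebra) : ℝ≥0∞ :=
  ⨆ (n : ℕ) (a : Matrix (Fin n) (Fin n) M.toStarSubalgebra)
    (_ : ‖matrixOperator (a.map fun T => (T : H →L[ℂ] H))‖ ≤ 1),
    ‖matrixOperator (a.map fun T => (Φ T : H →L[ℂ] H))‖ₑ

/-- A linear functional `ω` on a von Neumann algebra `M` of operators on `H` belongs to the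
predual `M_*`, i.e. it is `σ`-weakly continuous: `ω(T) = ∑ₙ ⟨T fₙ, gₙ⟩` with square-summable
sequences `(fₙ)` and `(gₙ)` in `H`. -/
def InPredual (M : VonNeumannAlgebra H) (ω : M.toStarSubalgebra →ₗ[ℂ] ℂ) : Prop :=
  ∃ f g : ℕ → H, (Summable fun n => ‖f n‖ ^ 2) ∧ (Summable fun n => ‖g n‖ ^ 2) ∧
    ∀ T : M.toStarSubalgebra, HasSum (fun n => ⟪g n, (T : H →L[ℂ] H) (f n)⟫_ℂ) (ω T)

/-- The von Neumann algebra generated by a set `S` of bounded operators: the double commutant of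
`S ∪ S*`. -/
def generatedVonNeumannAlgebra (S : Set (H →L[ℂ] H)) : VonNeumannAlgebra H where
  carrier := Set.centralizer (Set.centralizer (S ∪ star S))
  mul_mem' := Set.mul_mem_centralizer
  add_mem' := Set.add_mem_centralizer
  algebraMap_mem' r := fun _ _ => (Algebra.commutes r _).symm
  star_mem' := Set.star_mem_centralizer' fun _ => Set.star_mem_centralizer
  centralizer_centralizer' := by
    rw [Set.centralizer_centralizer_centralizer]

theorem mem_generatedVonNeumannAlgebra {S : Set (H →L[ℂ] H)} {T : H →L[ℂ] H} (hT : T ∈ S) :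
    T ∈ (generatedVonNeumannAlgebra S).toStarSubalgebra :=
  Set.subset_centralizer_centralizer (Set.mem_union_left _ hT)

end Operators

/-! ### The regular representation, the group von Neumann algebra and the Fourier algebra -/

section Group

variable {G : Type*} [Group G] [TopologicalSpace G] [IsTopologicalGroup G]
  [MeasurableSpace G] [BorelSpace G] (μ : Measure G) [μ.IsHaarMeasure]

/-- The left regular representation on `L²(G)`: `(λ(x) f)(y) = f(x⁻¹ y)`. -/
def leftRegular (x : G) : Lp ℂ 2 μ →L[ℂ] Lp ℂ 2 μ :=
  (Lp.compMeasurePreservingₗᵢ ℂ (fun y : G => x⁻¹ * y)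
    (measurePreserving_mul_left μ x⁻¹)).toContinuousLinearMap

/-- The group von Neumann algebra `𝔐(G)`, generated by the left regular representation. -/
def groupVN : VonNeumannAlgebra (Lp ℂ 2 μ) :=
  generatedVonNeumannAlgebra (Set.range (leftRegular μ))

/-- `λ(x)` as an element of `𝔐(G)`. -/
def leftRegularVN (x : G) : (groupVN μ).toStarSubalgebra :=
  ⟨leftRegular μ x, mem_generatedVonNeumannAlgebra ⟨x, rfl⟩⟩

/-- The function `ψ` on `G` is the element of the Fourier algebra that corresponds to the
functional `ω` in the predual of `𝔐(G)`: `ψ(x) = ω(λ(x))`. -/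
def Represents (ω : (groupVN μ).toStarSubalgebra →ₗ[ℂ] ℂ) (ψ : G → ℂ) : Prop :=
  InPredual (groupVN μ) ω ∧ ∀ x, ψ x = ω (leftRegularVN μ x)

/-- The Fourier algebra `A(G)`: the predual of `𝔐(G)`, realised as the space of the functions
`x ↦ ω(λ(x)) = ∑ₙ ⟨λ(x) fₙ, gₙ⟩` on `G`. -/
def fourierAlgebra : Set (G → ℂ) :=
  {ψ | ∃ ω, Represents μ ω ψ}

/-- `φ` is a multiplier of the Fourier algebra: it is continuous and `φ ψ ∈ A(G)` for every
`ψ ∈ A(G)`. -/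
def IsMultiplier (φ : G → ℂ) : Prop :=
  Continuous φ ∧ ∀ ψ ∈ fourierAlgebra μ, φ * ψ ∈ fourierAlgebra μ

/-- `Φ : 𝔐(G) → 𝔐(G)` is the transpose `m_φ^*` of the multiplication operator
`m_φ : A(G) → A(G)`, `m_φ ψ = φ ψ`, with respect to the duality between `A(G)` and `𝔐(G)`:
`⟨Φ T, ψ⟩ = ⟨T, φ ψ⟩` for all `T ∈ 𝔐(G)` and `ψ ∈ A(G)`. -/
def IsTranspose (φ : G → ℂ)
    (Φ : (groupVN μ).toStarSubalgebra →ₗ[ℂ] (groupVN μ).toStarSubalgebra) : Prop :=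
  ∀ (ψ : G → ℂ) (ω ω' : (groupVN μ).toStarSubalgebra →ₗ[ℂ] ℂ),
    Represents μ ω ψ → Represents μ ω' (φ * ψ) → ∀ T, ω (Φ T) = ω' T

/-- `φ ∈ M₀A(G)`: `φ` is a completely bounded multiplier of `A(G)`, i.e. a multiplier whose
transposed operator on `𝔐(G)` is completely bounded. -/
def IsCBMultiplier (φ : G → ℂ) : Prop :=
  IsMultiplier μ φ ∧ ∃ Φ, IsTranspose μ φ Φ ∧ cbNorm (groupVN μ) Φ < ∞

/-- The norm `‖φ‖_{M₀A(G)}` of a completely bounded multiplier: the completely bounded norm of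
the transposed operator of `φ` (for a multiplier `φ` the transpose is
unique, so that the infimum has just one term). -/
def cbMultiplierNorm (φ : G → ℂ) : ℝ≥0∞ :=
  ⨅ (Φ) (_ : IsTranspose μ φ Φ), cbNorm (groupVN μ) Φ

end Group

/-! ### Representing functions through maps into Hilbert spaces -/

section Coefficients

variable {G : Type*} [Group G] {H : Type*} [NormedAddCommGroup H] [InnerProductSpace ℂ H]

/-- `ξ, η : G → H` are bounded maps with `φ(y⁻¹ x) = ⟨ξ(x), η(y)⟩` for all `x, y` and
`(sup ‖ξ(x)‖) (sup ‖η(y)‖) ≤ k`. Mathlib's inner product is linear in the second variable. -/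
def IsGilbertPair (φ : G → ℂ) (k : ℝ) (ξ η : G → H) : Prop :=
  BddAbove (Set.range fun x => ‖ξ x‖) ∧ BddAbove (Set.range fun y => ‖η y‖) ∧
    (∀ x y : G, φ (y⁻¹ * x) = ⟪η y, ξ x⟫_ℂ) ∧
    (⨆ x, ‖ξ x‖) * (⨆ y, ‖η y‖) ≤ k

/-- A family of complex functions on a space is locally countable if every point has a
neighbourhood on which all but countably many members of the family vanish identically. -/
def LocallyCountable {X : Type*} [TopologicalSpace X] {ι : Type*} (f : ι → X → ℂ) : Prop :=
  ∀ x, ∃ U ∈ 𝓝 x, {i | ∃ y ∈ U, f i y ≠ 0}.Countable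

/-- The coordinate functions `x ↦ ⟨ξ(x), eᵢ⟩` of a map `ξ` into a Hilbert space with respect to an
orthonormal basis are continuous, and they form a locally countable family. -/
def HasGoodCoordinates {X : Type*} [TopologicalSpace X] {ι : Type*}
    (e : HilbertBasis ι ℂ H) (ξ : X → H) : Prop :=
  (∀ i, Continuous fun x => ⟪e i, ξ x⟫_ℂ) ∧ LocallyCountable fun i x => ⟪e i, ξ x⟫_ℂ

end Coefficients

end

end HerzSchur

/-!
The Schur bound says that the real functional prescribed by the diagonal `k` and the off-diagonal
block `φ (y⁻¹ * x)` on `G ⊕ G` is nonnegative on the positive semidefinite matrices supported on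
these entries. By the M. Riesz extension theorem the prescribed entries therefore have a positive
semidefinite completion, and its Gram vectors are `ξ` and `η`.

Projecting onto a subspace of `H` on which both families become total preserves `⟨ξ x, η y⟩`, and
there continuity of `φ` makes `ξ` and `η` weakly continuous. Local countability of the coordinates
follows from Bessel's inequality, integrated over a neighbourhood of finite Haar measure.

With `mᵢ y = ⟨ξ y⁻¹, eᵢ⟩` and `nᵢ y = ⟨η y⁻¹, eᵢ⟩` acting by multiplication on `L²(G)`, the map
`T ↦ ∑ᵢ nᵢ* T mᵢ = W* (T ⊗ 1) V` sends `λ(x)` to `φ(x) λ(x)` and has completely bounded norm at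
most `‖W‖ ‖V‖ ≤ k`. Conversely, a completely bounded transpose of `m_φ` acts on matrices
`[b i j • λ(xᵢ⁻¹ xⱼ)]`, whose norm is that of `b`, as the Schur multiplier.
-/

namespace HerzSchur

open ComplexConjugate
open scoped Matrix ComplexOrder lp

section SchurKernels

theorem dotProduct_mulVec_eq_inner {ι : Type*} [Fintype ι] [DecidableEq ι] (B : Matrix ι ι ℂ)
    (u v : ι → ℂ) : u ⬝ᵥ B *ᵥ v =
      ⟪WithLp.toLp 2 (star u), Matrix.toEuclideanCLM (𝕜 := ℂ) B (WithLp.toLp 2 v)⟫_ℂ := by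
  rw [Matrix.toEuclideanCLM_toLp, EuclideanSpace.inner_toLp_toLp, star_star, dotProduct_comm]

theorem norm_toLp_star {ι : Type*} [Fintype ι] (u : ι → ℂ) :
    ‖WithLp.toLp 2 (star u)‖ = ‖WithLp.toLp 2 u‖ := by
  simp only [EuclideanSpace.norm_eq, Pi.star_apply, norm_star]

theorem norm_dotProduct_mulVec_le {ι : Type*} [Fintype ι] [DecidableEq ι] (B : Matrix ι ι ℂ)
    (u v : ι → ℂ) : ‖u ⬝ᵥ B *ᵥ v‖ ≤
      ‖Matrix.toEuclideanCLM (𝕜 := ℂ) B‖ * (‖WithLp.toLp 2 u‖ * ‖WithLp.toLp 2 v‖) := by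
  rw [dotProduct_mulVec_eq_inner, ← norm_toLp_star u, mul_left_comm]
  exact (norm_inner_le_norm _ _).trans
    (mul_le_mul_of_nonneg_left (ContinuousLinearMap.le_opNorm _ _) (norm_nonneg _))

theorem norm_toEuclideanCLM_le_one_of_two_mul_re_le {ι : Type*} [Fintype ι] [DecidableEq ι]
    {B : Matrix ι ι ℂ}
    (h : ∀ u v : ι → ℂ, 2 * (u ⬝ᵥ B *ᵥ v).re ≤ ∑ i, ‖u i‖ ^ 2 + ∑ i, ‖v i‖ ^ 2) :
    ‖Matrix.toEuclideanCLM (𝕜 := ℂ) B‖ ≤ 1 := by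
  refine ContinuousLinearMap.opNorm_le_of_re_inner_le zero_le_one fun v u hv hu => ?_
  have huv := h (star u.ofLp) v.ofLp
  rw [dotProduct_mulVec_eq_inner, star_star, ← inner_conj_symm, Complex.conj_re] at huv
  simp only [Pi.star_apply, norm_star, ← EuclideanSpace.norm_sq_eq, hu, hv] at huv
  norm_num at huv
  exact huv

theorem schurNorm_le_iff {n : ℕ} (a : Matrix (Fin n) (Fin n) ℂ) {k : ℝ} (hk : 0 ≤ k) :
    schurNorm a ≤ ENNReal.ofReal k ↔ ∀ b : Matrix (Fin n) (Fin n) ℂ,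
      ‖Matrix.toEuclideanCLM (𝕜 := ℂ) b‖ ≤ 1 →
        ‖Matrix.toEuclideanCLM (𝕜 := ℂ) (a.hadamard b)‖ ≤ k := by
  simp only [schurNorm, iSup_le_iff]
  refine forall_congr' fun b => imp_congr_right fun _ => ?_
  rw [← ofReal_norm, ENNReal.ofReal_le_ofReal_iff hk]

theorem eq_zero_of_forall_add_re_mul_nonneg {β : ℝ} {c : ℂ} (h : ∀ z : ℂ, 0 ≤ β + (z * c).re) :
    c = 0 := by
  by_contra hc
  have := h (-(β + 1 : ℝ) / c)
  rw [div_mul_cancel₀ _ hc, Complex.neg_re, Complex.ofReal_re] at this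
  linarith

section Duality

variable {ι : Type*} [Fintype ι]

/-- Positivity of the Hermitian matrix with blocks `diag d`, `diag e` and off-diagonal block `C/2`,
written as a quadratic form in which `u` enters through its conjugate. -/
def IsBlockPositive (d e : ι → ℝ) (C : Matrix ι ι ℂ) : Prop :=
  ∀ u v : ι → ℂ, 0 ≤ ∑ i, d i * ‖u i‖ ^ 2 + ∑ j, e j * ‖v j‖ ^ 2 + (u ⬝ᵥ C *ᵥ v).re

namespace IsBlockPositive

variable {d e : ι → ℝ} {C : Matrix ι ι ℂ} (h : IsBlockPositive d e C)
include h

theorem left_nonneg (i : ι) : 0 ≤ d i := by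
  classical
  simpa [Pi.single_apply, apply_ite] using h (Pi.single i 1) 0

theorem right_nonneg (j : ι) : 0 ≤ e j := by
  classical
  simpa [Pi.single_apply, apply_ite] using h 0 (Pi.single j 1)

theorem eq_zero_of_left_eq_zero {i : ι} (hi : d i = 0) (j : ι) : C i j = 0 := by
  classical
  refine eq_zero_of_forall_add_re_mul_nonneg (β := e j) fun z => ?_
  simpa [Pi.single_apply, apply_ite, hi] using h (Pi.single i z) (Pi.single j 1)

theorem eq_zero_of_right_eq_zero (i : ι) {j : ι} (hj : e j = 0) : C i j = 0 := by
  classical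
  refine eq_zero_of_forall_add_re_mul_nonneg (β := d i) fun z => ?_
  simpa [Pi.single_apply, apply_ite, hj, mul_comm] using h (Pi.single i 1) (Pi.single j z)

/-- The division by `0` on a row with `d i = 0` or a column with `e j = 0` is harmless: there `C`
vanishes. -/
theorem exists_factorization [DecidableEq ι] : ∃ B : Matrix ι ι ℂ,
    ‖Matrix.toEuclideanCLM (𝕜 := ℂ) B‖ ≤ 1 ∧ ∀ i j, C i j = 2 * (√(d i) * B i j * √(e j)) := by
  refine ⟨Matrix.of fun i j => C i j / (2 * √(d i) * √(e j)),
    norm_toEuclideanCLM_le_one_of_two_mul_re_le fun u v => ?_, fun i j => ?_⟩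
  · have hsq : ∀ {r : ℝ} (z : ℂ), 0 ≤ r → r * ‖z / √r‖ ^ 2 ≤ ‖z‖ ^ 2 := fun {r} z hr => by
      rw [norm_div, Complex.norm_real, div_pow, Real.norm_eq_abs, sq_abs, Real.sq_sqrt hr,
        mul_div_left_comm]
      exact mul_le_of_le_one_right (sq_nonneg _) (div_self_le_one _)
    have huv := h (fun i => -u i / √(d i)) (fun j => v j / √(e j))
    have hu := Finset.sum_le_sum fun i (_ : i ∈ Finset.univ) => hsq (-u i) (h.left_nonneg i)
    have hv := Finset.sum_le_sum fun j (_ : j ∈ Finset.univ) => hsq (v j) (h.right_nonneg j)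
    have hC : (fun i => -u i / √(d i)) ⬝ᵥ C *ᵥ (fun j => v j / √(e j)) =
        (-2 : ℝ) * (u ⬝ᵥ (Matrix.of fun i j => C i j / (2 * √(d i) * √(e j))) *ᵥ v) := by
      simp only [dotProduct, Matrix.mulVec, Finset.mul_sum, Matrix.of_apply]
      refine Finset.sum_congr rfl fun i _ => Finset.sum_congr rfl fun j _ => ?_
      push_cast
      ring
    rw [hC, Complex.re_ofReal_mul] at huv
    simp only [norm_neg] at hu
    linarith
  · rcases (h.left_nonneg i).eq_or_lt with hi | hi
    · simp [h.eq_zero_of_left_eq_zero hi.symm j]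
    rcases (h.right_nonneg j).eq_or_lt with hj | hj
    · simp [h.eq_zero_of_right_eq_zero i hj.symm]
    have hdi : (√(d i) : ℂ) ≠ 0 := by exact_mod_cast (Real.sqrt_pos.2 hi).ne'
    have hej : (√(e j) : ℂ) ≠ 0 := by exact_mod_cast (Real.sqrt_pos.2 hj).ne'
    rw [Matrix.of_apply]
    field_simp

end IsBlockPositive

theorem IsBlockPositive.re_sum_mul_nonneg {n : ℕ} {d e : Fin n → ℝ}
    {C a : Matrix (Fin n) (Fin n) ℂ} (h : IsBlockPositive d e C) {k : ℝ} (hk : 0 ≤ k)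
    (ha : schurNorm a ≤ ENNReal.ofReal k) :
    0 ≤ k * (∑ i, d i + ∑ j, e j) + (∑ i, ∑ j, C i j * a i j).re := by
  obtain ⟨B, hB, hC⟩ := h.exists_factorization
  have hsum : ∑ i, ∑ j, C i j * a i j =
      (2 : ℝ) * ((fun i => (√(d i) : ℂ)) ⬝ᵥ a.hadamard B *ᵥ fun j => (√(e j) : ℂ)) := by
    simp only [dotProduct, Matrix.mulVec, Finset.mul_sum, Matrix.hadamard_apply, hC]
    refine Finset.sum_congr rfl fun i _ => Finset.sum_congr rfl fun j _ => ?_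
    push_cast
    ring
  have hnorm : ∀ f : Fin n → ℝ, (∀ i, 0 ≤ f i) →
      ‖WithLp.toLp 2 fun i => (√(f i) : ℂ)‖ ^ 2 = ∑ i, f i := fun f hf => by
    simp only [EuclideanSpace.norm_sq_eq, Complex.norm_real, Real.norm_eq_abs, sq_abs,
      Real.sq_sqrt (hf _)]
  have hle := (Complex.abs_re_le_norm _).trans <|
    (norm_dotProduct_mulVec_le (a.hadamard B) (fun i => (√(d i) : ℂ)) fun j => √(e j)).trans <|
      mul_le_mul_of_nonneg_right ((schurNorm_le_iff a hk).1 ha B hB) (by positivity)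
  rw [hsum, Complex.re_ofReal_mul, ← hnorm d h.left_nonneg, ← hnorm e h.right_nonneg]
  have := mul_le_mul_of_nonneg_left (two_mul_le_add_sq ‖WithLp.toLp 2 fun i => (√(d i) : ℂ)‖
    ‖WithLp.toLp 2 fun j => (√(e j) : ℂ)‖) hk
  linarith [neg_le_of_abs_le hle]

end Duality

/-! ### Gram representations of positive semidefinite kernels -/

theorem exists_gram_eq {α : Type u} {K : Matrix α α ℂ} (hK : K.PosSemidef) :
    ∃ (H : Type u) (_ : NormedAddCommGroup H) (_ : InnerProductSpace ℂ H) (_ : CompleteSpace H)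
      (v : α → H), Matrix.gram ℂ v = K := by
  let L : Matrix α α (ℂ →L[ℂ] ℂ) := K.map fun c => c • ContinuousLinearMap.id ℂ ℂ
  have herm : ∀ x y, conj (K x y) = K y x := fun x y => hK.1.apply y x
  have hL : L.PosSemidef := by
    have h := (RKHS.posSemidef_tfae (K := L)).out 0 2
    refine h.2 ⟨?_, fun f => ?_⟩
    · ext x y
      refine ext_inner_right ℂ fun w => ?_
      rw [Matrix.conjTranspose_apply, ContinuousLinearMap.star_eq_adjoint,
        ContinuousLinearMap.adjoint_inner_left]
      simp [L, herm, mul_comm]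
    · refine (Complex.nonneg_iff.1 (hK.2 f)).1.trans_eq (congrArg Complex.re ?_)
      refine Finsupp.sum_congr fun x _ => Finsupp.sum_congr fun y _ => ?_
      simp [L, herm]
      ring
  have : Fact L.PosSemidef := ⟨hL⟩
  refine ⟨RKHS.OfKernel L, inferInstance, inferInstance, inferInstance,
    fun x => RKHS.kerFun (RKHS.OfKernel L) x 1, ?_⟩
  ext x y
  rw [Matrix.gram_apply, ← RKHS.kernel_inner, RKHS.OfKernel.kernel_ofKernel]
  simp [L, herm]

/-! ### Completion of partially defined kernels -/

/-- The pairing `Re ∑ M p q * K p q` of a matrix `M` of finite support with a kernel `K`. -/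
noncomputable def matrixPairing {α : Type*} (K : Matrix α α ℂ) : (α × α →₀ ℂ) →ₗ[ℝ] ℝ :=
  Complex.reLm ∘ₗ (Finsupp.linearCombination ℂ fun p => K p.1 p.2).restrictScalars ℝ

theorem matrixPairing_apply {α : Type*} (K : Matrix α α ℂ) (M : α × α →₀ ℂ) :
    matrixPairing K M = (M.sum fun p c => c * K p.1 p.2).re := rfl

theorem matrixPairing_single {α : Type*} (K : Matrix α α ℂ) (p : α × α) (c : ℂ) :
    matrixPairing K (Finsupp.single p c) = (c * K p.1 p.2).re := by
  simp [matrixPairing_apply]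

theorem exists_matrixPairing_eq {α : Type*} (g : (α × α →₀ ℂ) →ₗ[ℝ] ℝ) :
    ∃ K : Matrix α α ℂ, matrixPairing K = g := by
  let f : Module.Dual ℂ (α × α →₀ ℂ) := Module.Dual.extendRCLike g
  refine ⟨Matrix.of fun p q => f (Finsupp.single (p, q) 1), Finsupp.lhom_ext fun p c => ?_⟩
  have hf : f (Finsupp.single p c) = c * f (Finsupp.single p 1) := by
    rw [← smul_eq_mul, ← map_smul, Finsupp.smul_single_one]
  rw [matrixPairing_single, Matrix.of_apply, ← hf]
  exact Module.Dual.re_extendRCLike_apply (𝕜 := ℂ) g _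

/-- The cone of the finitely supported matrices whose real part is positive semidefinite,
described as the dual cone of the rank one kernels. -/
def psdCone (α : Type*) : PointedCone ℝ (α × α →₀ ℂ) where
  carrier := {M | ∀ w : α → ℂ, 0 ≤ matrixPairing (Matrix.vecMulVec (star w) w) M}
  add_mem' hM hN w := by simpa only [map_add] using add_nonneg (hM w) (hN w)
  zero_mem' w := by simp only [map_zero, le_refl]
  smul_mem' c M hM w := by
    rw [← Nonneg.coe_smul, map_smul]
    exact smul_nonneg c.2 (hM w)

theorem eq_of_forall_re_mul_eq {z w : ℂ} (h : ∀ c : ℂ, (c * z).re = (c * w).re) : z = w :=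
  sub_eq_zero.1 <| eq_zero_of_forall_add_re_mul_nonneg (β := 0) fun c => by
    rw [mul_sub, Complex.sub_re, h, sub_self, zero_add]

theorem isHermitian_of_matrixPairing_nonneg {α : Type*} {K : Matrix α α ℂ}
    (h : ∀ M ∈ psdCone α, 0 ≤ matrixPairing K M) : K.IsHermitian := by
  have hskew : ∀ p q : α, ∀ c : ℂ,
      Finsupp.single (q, p) c - Finsupp.single (p, q) (conj c) ∈ psdCone α := by
    intro p q c w
    rw [map_sub, matrixPairing_single, matrixPairing_single]
    simp only [Matrix.vecMulVec_apply, Pi.star_apply, RCLike.star_def, Complex.mul_re,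
      Complex.mul_im, Complex.conj_re, Complex.conj_im]
    ring_nf
    rfl
  ext p q
  rw [Matrix.conjTranspose_apply, RCLike.star_def]
  refine eq_of_forall_re_mul_eq fun c => ?_
  have hpos := h _ (hskew q p c)
  have hneg := h _ (hskew q p (-c))
  simp only [map_sub, matrixPairing_single, map_neg, neg_mul, Complex.neg_re] at hpos hneg
  rw [← Complex.conj_re, map_mul, Complex.conj_conj]
  linarith

theorem re_sum_nonneg_of_matrixPairing_nonneg {α : Type*} {K : Matrix α α ℂ}
    (h : ∀ M ∈ psdCone α, 0 ≤ matrixPairing K M) (f : α →₀ ℂ) :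
    0 ≤ (f.sum fun p z => f.sum fun q w => star z * K p q * w).re := by
  let M : α × α →₀ ℂ := f.sum fun p z => f.sum fun q w => Finsupp.single (p, q) (conj z * w)
  have hM : ∀ L : Matrix α α ℂ, matrixPairing L M =
      (f.sum fun p z => f.sum fun q w => star z * L p q * w).re := fun L => by
    simp only [M, Finsupp.sum, map_sum, matrixPairing_single, Complex.re_sum, mul_right_comm,
      RCLike.star_def]
  rw [← hM]
  refine h M fun w => ?_
  have hsq : (f.sum fun p z => f.sum fun q z' =>
      star z * Matrix.vecMulVec (star w) w p q * z') =
      conj (f.sum fun p z => z * w p) * f.sum fun p z => z * w p := by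
    simp only [Finsupp.sum, map_sum, Finset.sum_mul_sum, Matrix.vecMulVec_apply, map_mul,
      Pi.star_apply, RCLike.star_def]
    exact Finset.sum_congr rfl fun p _ => Finset.sum_congr rfl fun q _ => by ring
  rw [hM, hsq, Complex.conj_mul', ← Complex.ofReal_pow, Complex.ofReal_re]
  positivity

theorem posSemidef_of_matrixPairing_nonneg {α : Type*} {K : Matrix α α ℂ}
    (h : ∀ M ∈ psdCone α, 0 ≤ matrixPairing K M) : K.PosSemidef := by
  have herm := isHermitian_of_matrixPairing_nonneg h
  refine ⟨herm, fun f =>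
    Complex.nonneg_iff.2 ⟨re_sum_nonneg_of_matrixPairing_nonneg h f, Eq.symm ?_⟩⟩
  refine Complex.conj_eq_iff_im.1 ?_
  simp only [Finsupp.sum, map_sum, map_mul, RCLike.star_def, Complex.conj_conj]
  rw [Finset.sum_comm]
  refine Finset.sum_congr rfl fun p _ => Finset.sum_congr rfl fun q _ => ?_
  rw [show conj (K q p) = K p q from herm.apply p q]
  ring

variable {X : Type*}

/-- The matrices over `X ⊕ X` whose two diagonal blocks are diagonal. -/
def diagonalBlocks (X : Type*) : Submodule ℝ ((X ⊕ X) × (X ⊕ X) →₀ ℂ) where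
  carrier := {M | ∀ x y, x ≠ y → M (Sum.inl x, Sum.inl y) = 0 ∧ M (Sum.inr x, Sum.inr y) = 0}
  add_mem' hM hN x y hxy := by simp [hM x y hxy, hN x y hxy]
  zero_mem' x y _ := by simp
  smul_mem' c M hM x y hxy := by simp [hM x y hxy]

theorem single_diag_mem_diagonalBlocks (q : X ⊕ X) (r : ℂ) :
    Finsupp.single (q, q) r ∈ diagonalBlocks X := by
  classical
  intro x y hxy
  constructor <;> rw [Finsupp.single_apply, if_neg] <;> rintro ⟨⟩ <;> exact hxy rfl

theorem single_inr_inl_mem_diagonalBlocks (x y : X) (c : ℂ) :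
    Finsupp.single (Sum.inr y, Sum.inl x) c ∈ diagonalBlocks X := fun _ _ _ => by simp

theorem exists_add_mem_psdCone (M : (X ⊕ X) × (X ⊕ X) →₀ ℂ) :
    ∃ D ∈ diagonalBlocks X, D + M ∈ psdCone (X ⊕ X) := by
  induction M using Finsupp.induction_linear with
  | zero => exact ⟨0, zero_mem _, (zero_add (0 : (X ⊕ X) × (X ⊕ X) →₀ ℂ)).symm ▸ zero_mem _⟩
  | add M N hM hN =>
    obtain ⟨D, hD, hDM⟩ := hM
    obtain ⟨E, hE, hEN⟩ := hN
    exact ⟨D + E, add_mem hD hE, add_add_add_comm D E M N ▸ add_mem hDM hEN⟩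
  | single p c =>
    refine ⟨Finsupp.single (p.1, p.1) (‖c‖ : ℂ) + Finsupp.single (p.2, p.2) (‖c‖ : ℂ),
      add_mem (single_diag_mem_diagonalBlocks _ _) (single_diag_mem_diagonalBlocks _ _),
      fun w => ?_⟩
    have hsq : ∀ z : ℂ, ((‖c‖ : ℂ) * (conj z * z)).re = ‖c‖ * ‖z‖ ^ 2 := fun z => by
      rw [Complex.conj_mul', Complex.re_ofReal_mul, ← Complex.ofReal_pow, Complex.ofReal_re]
    have hle := neg_le_of_abs_le (Complex.abs_re_le_norm (c * (conj (w p.1) * w p.2)))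
    simp only [map_add, matrixPairing_single, Matrix.vecMulVec_apply, Pi.star_apply,
      RCLike.star_def, hsq]
    rw [norm_mul, norm_mul, RCLike.norm_conj] at hle
    nlinarith [mul_nonneg (norm_nonneg c) (sq_nonneg (‖w p.1‖ - ‖w p.2‖)),
      mul_nonneg (norm_nonneg c) (sq_nonneg ‖w p.1‖),
      mul_nonneg (norm_nonneg c) (sq_nonneg ‖w p.2‖)]

/-- The Schur multiplier norms of the finite submatrices of the kernel `a` are at most `k`. -/
def IsSchurBounded (a : Matrix X X ℂ) (k : ℝ) : Prop :=
  ∀ (n : ℕ) (x : Fin n → X), Function.Injective x →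
    schurNorm (a.submatrix x x) ≤ ENNReal.ofReal k

open Classical in
/-- The partially prescribed kernel on `X ⊕ X` with diagonal `k` and lower left block `aᵀ`; the
zeros in its diagonal blocks stand for the entries that are not prescribed. -/
noncomputable def blockKernel (a : Matrix X X ℂ) (k : ℝ) : Matrix (X ⊕ X) (X ⊕ X) ℂ :=
  Matrix.fromBlocks ((k : ℂ) • 1) (a.map star) aᵀ ((k : ℂ) • 1)

theorem isHermitian_blockKernel (a : Matrix X X ℂ) (k : ℝ) : (blockKernel a k).IsHermitian := by
  classical
  have hdiag : ((k : ℂ) • (1 : Matrix X X ℂ)).IsHermitian := by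
    simp [Matrix.IsHermitian, Matrix.conjTranspose_smul]
  exact hdiag.fromBlocks (by ext; simp) hdiag

theorem exists_embedding_support_subset (M : (X ⊕ X) × (X ⊕ X) →₀ ℂ) :
    ∃ (n : ℕ) (x : Fin n ↪ X), M.support ⊆
      (Finset.univ.map (x.sumMap x)) ×ˢ (Finset.univ.map (x.sumMap x)) := by
  classical
  let T : Finset (X ⊕ X) := M.support.image Prod.fst ∪ M.support.image Prod.snd
  let S : Finset X := T.toLeft ∪ T.toRight
  have hT : ∀ q ∈ T, q ∈ Finset.univ.map
      ((S.equivFin.symm.toEmbedding.trans (Function.Embedding.subtype _)).sumMap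
        (S.equivFin.symm.toEmbedding.trans (Function.Embedding.subtype _))) := by
    rintro (q | q) hq
    · have hqS : q ∈ S := Finset.mem_union_left _ (Finset.mem_toLeft.2 hq)
      exact Finset.mem_map.2 ⟨Sum.inl (S.equivFin ⟨q, hqS⟩), Finset.mem_univ _, by simp⟩
    · have hqS : q ∈ S := Finset.mem_union_right _ (Finset.mem_toRight.2 hq)
      exact Finset.mem_map.2 ⟨Sum.inr (S.equivFin ⟨q, hqS⟩), Finset.mem_univ _, by simp⟩
  exact ⟨S.card, _, fun p hp => Finset.mem_product.2
    ⟨hT _ (Finset.mem_union_left _ (Finset.mem_image_of_mem _ hp)),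
      hT _ (Finset.mem_union_right _ (Finset.mem_image_of_mem _ hp))⟩⟩

/-- Against a Hermitian kernel, the two off-diagonal blocks of `M` contribute through a single
matrix. -/
theorem matrixPairing_eq_of_isHermitian {M : (X ⊕ X) × (X ⊕ X) →₀ ℂ} (hM : M ∈ diagonalBlocks X)
    {n : ℕ} {x : Fin n ↪ X} (hx : M.support ⊆
      (Finset.univ.map (x.sumMap x)) ×ˢ (Finset.univ.map (x.sumMap x)))
    {K : Matrix (X ⊕ X) (X ⊕ X) ℂ} (hK : K.IsHermitian) :
    matrixPairing K M =
      ∑ i, (M (.inl (x i), .inl (x i))).re * (K (.inl (x i)) (.inl (x i))).re +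
      ∑ i, (M (.inr (x i), .inr (x i))).re * (K (.inr (x i)) (.inr (x i))).re +
      (∑ i, ∑ j, (M (.inr (x j), .inl (x i)) + conj (M (.inl (x i), .inr (x j)))) *
        K (.inr (x j)) (.inl (x i))).re := by
  have hdiag : ∀ p, ∀ z : ℂ, (z * K p p).re = z.re * (K p p).re := fun p z => by
    rw [← hK.coe_re_apply_self p]
    simp
  have hl : ∀ i, ∑ j, M (.inl (x i), .inl (x j)) * K (.inl (x i)) (.inl (x j)) =
      M (.inl (x i), .inl (x i)) * K (.inl (x i)) (.inl (x i)) := fun i =>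
    Fintype.sum_eq_single i fun j hj => by rw [(hM _ _ (x.injective.ne hj.symm)).1, zero_mul]
  have hr : ∀ i, ∑ j, M (.inr (x i), .inr (x j)) * K (.inr (x i)) (.inr (x j)) =
      M (.inr (x i), .inr (x i)) * K (.inr (x i)) (.inr (x i)) := fun i =>
    Fintype.sum_eq_single i fun j hj => by rw [(hM _ _ (x.injective.ne hj.symm)).2, zero_mul]
  have hlr : ∀ i j, (M (.inl (x i), .inr (x j)) * K (.inl (x i)) (.inr (x j))).re =
      (conj (M (.inl (x i), .inr (x j))) * K (.inr (x j)) (.inl (x i))).re := fun i j => by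
    rw [← hK.apply, RCLike.star_def, ← Complex.conj_re, map_mul, Complex.conj_conj]
  rw [matrixPairing_apply, Finsupp.sum_of_support_subset _ hx _ (by simp), Finset.sum_product]
  simp only [Finset.sum_map, Fintype.sum_sum_type, Function.Embedding.coe_sumMap,
    Sum.map_inl, Sum.map_inr, Finset.sum_add_distrib, hl, hr, add_mul, Complex.add_re,
    Complex.re_sum, hdiag, hlr]
  rw [Finset.sum_comm (f := fun j i => (M (.inr (x j), .inl (x i)) * _ : ℂ).re)]
  ring

theorem isHermitian_vecMulVec_star_self {α : Type*} (w : α → ℂ) :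
    (Matrix.vecMulVec (star w) w).IsHermitian := by
  rw [Matrix.IsHermitian, Matrix.conjTranspose_vecMulVec, star_star]

theorem IsSchurBounded.matrixPairing_blockKernel_nonneg {a : Matrix X X ℂ} {k : ℝ} (hk : 0 ≤ k)
    (ha : IsSchurBounded a k) {M : (X ⊕ X) × (X ⊕ X) →₀ ℂ} (hM : M ∈ diagonalBlocks X)
    (hpos : M ∈ psdCone (X ⊕ X)) : 0 ≤ matrixPairing (blockKernel a k) M := by
  classical
  obtain ⟨n, x, hx⟩ := exists_embedding_support_subset M
  have hblock : IsBlockPositive (fun i => (M (.inl (x i), .inl (x i))).re)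
      (fun i => (M (.inr (x i), .inr (x i))).re)
      (Matrix.of fun i j => M (.inr (x j), .inl (x i)) + conj (M (.inl (x i), .inr (x j)))) := by
    intro u v
    let w : X ⊕ X → ℂ := Sum.elim (Function.extend x u 0) (Function.extend x (star v) 0)
    have hwl : ∀ i, w (.inl (x i)) = u i := fun i => x.injective.extend_apply u 0 i
    have hwr : ∀ i, w (.inr (x i)) = conj (v i) := fun i => x.injective.extend_apply (star v) 0 i
    refine (hpos w).trans_eq ?_
    rw [matrixPairing_eq_of_isHermitian hM hx (isHermitian_vecMulVec_star_self w)]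
    have hsq : ∀ z : ℂ, (conj z * z).re = ‖z‖ ^ 2 := fun z => by
      rw [Complex.conj_mul', ← Complex.ofReal_pow, Complex.ofReal_re]
    have hsq' : ∀ z : ℂ, (z * conj z).re = ‖z‖ ^ 2 := fun z => by rw [mul_comm, hsq]
    have hbil : u ⬝ᵥ (Matrix.of fun i j => M (.inr (x j), .inl (x i)) +
        conj (M (.inl (x i), .inr (x j)))) *ᵥ v = ∑ i, ∑ j, (M (.inr (x j), .inl (x i)) +
          conj (M (.inl (x i), .inr (x j)))) * (v j * u i) := by
      simp only [dotProduct, Matrix.mulVec, Matrix.of_apply, Finset.mul_sum]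
      exact Finset.sum_congr rfl fun i _ => Finset.sum_congr rfl fun j _ => by ring
    simp only [hbil, Matrix.vecMulVec_apply, Pi.star_apply, RCLike.star_def, hwl, hwr, hsq,
      hsq', Complex.conj_conj]
  have := hblock.re_sum_mul_nonneg hk (ha n x x.injective)
  rw [matrixPairing_eq_of_isHermitian hM hx (isHermitian_blockKernel a k)]
  simp only [blockKernel, Matrix.fromBlocks_apply₁₁, Matrix.fromBlocks_apply₂₂,
    Matrix.fromBlocks_apply₂₁, Matrix.smul_apply, Matrix.one_apply_eq, Matrix.transpose_apply]
  simpa [mul_add, Finset.mul_sum, mul_comm] using this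

/-- The prescribed entries give a linear functional on `diagonalBlocks X` that is nonnegative on
positive semidefinite matrices; any positive extension of it is a completion of the kernel. -/
theorem IsSchurBounded.exists_posSemidef {a : Matrix X X ℂ} {k : ℝ} (hk : 0 ≤ k)
    (ha : IsSchurBounded a k) : ∃ K : Matrix (X ⊕ X) (X ⊕ X) ℂ, K.PosSemidef ∧
      (∀ p, K p p = k) ∧ ∀ x y, K (.inr y) (.inl x) = a x y := by
  classical
  obtain ⟨g, hgf, hg⟩ := riesz_extension (psdCone (X ⊕ X))
    ⟨diagonalBlocks X, (matrixPairing (blockKernel a k)).domRestrict _⟩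
    (fun M hM => ha.matrixPairing_blockKernel_nonneg hk M.2 hM)
    (fun M => let ⟨D, hD, h⟩ := exists_add_mem_psdCone M; ⟨⟨D, hD⟩, h⟩)
  obtain ⟨K, rfl⟩ := exists_matrixPairing_eq g
  have hK : ∀ p q, (∀ c, Finsupp.single (p, q) c ∈ diagonalBlocks X) →
      K p q = blockKernel a k p q := fun p q h => eq_of_forall_re_mul_eq fun c => by
    exact (matrixPairing_single K (p, q) c).symm.trans
      ((hgf ⟨_, h c⟩).trans (matrixPairing_single _ (p, q) c))
  refine ⟨K, posSemidef_of_matrixPairing_nonneg hg, fun p => ?_, fun x y => ?_⟩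
  · rw [hK p p (single_diag_mem_diagonalBlocks p)]
    cases p <;> simp [blockKernel]
  · rw [hK _ _ (single_inr_inl_mem_diagonalBlocks x y)]
    rfl

theorem IsSchurBounded.exists_inner_eq {X : Type u} {a : Matrix X X ℂ} {k : ℝ} (hk : 0 ≤ k)
    (ha : IsSchurBounded a k) :
    ∃ (H : Type u) (_ : NormedAddCommGroup H) (_ : InnerProductSpace ℂ H) (_ : CompleteSpace H)
      (ξ η : X → H), (∀ x y, a x y = ⟪η y, ξ x⟫_ℂ) ∧ (∀ x, ‖ξ x‖ = √k) ∧ ∀ y, ‖η y‖ = √k := by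
  obtain ⟨K, hK, hdiag, hKa⟩ := ha.exists_posSemidef hk
  obtain ⟨H, _, _, _, v, hv⟩ := exists_gram_eq hK
  have hnorm : ∀ p, ‖v p‖ = √k := fun p => by
    have hp : ⟪v p, v p⟫_ℂ = k := by rw [← Matrix.gram_apply, hv, hdiag]
    rw [norm_eq_sqrt_re_inner (𝕜 := ℂ), hp]
    rfl
  refine ⟨H, inferInstance, inferInstance, inferInstance, fun x => v (.inl x),
    fun y => v (.inr y), fun x y => ?_, fun x => hnorm _, fun y => hnorm _⟩
  rw [← hKa, ← hv, Matrix.gram_apply]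

theorem exists_isGilbertPair_of_schurNorm_le {G : Type u} [Group G] {φ : G → ℂ} {k : ℝ}
    (hk : 0 ≤ k) (h : ∀ (n : ℕ) (x : Fin n → G), Function.Injective x →
      schurNorm (Matrix.of fun i j => φ ((x j)⁻¹ * x i)) ≤ ENNReal.ofReal k) :
    ∃ (H : Type (max u v)) (_ : NormedAddCommGroup H) (_ : InnerProductSpace ℂ H)
      (_ : CompleteSpace H) (ξ η : G → H), IsGilbertPair φ k ξ η := by
  have ha : IsSchurBounded
      (Matrix.of fun x y : ULift.{v} G => φ (y.down⁻¹ * x.down)) k := fun n x hx =>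
    h n (fun i => (x i).down) (ULift.down_injective.comp hx)
  obtain ⟨H, _, _, _, ξ, η, hφ, hξ, hη⟩ := ha.exists_inner_eq hk
  refine ⟨H, inferInstance, inferInstance, inferInstance, fun x => ξ ⟨x⟩, fun y => η ⟨y⟩,
    ?_, ?_, fun x y => hφ ⟨x⟩ ⟨y⟩, ?_⟩
  · exact ⟨√k, Set.forall_mem_range.2 fun x => (hξ _).le⟩
  · exact ⟨√k, Set.forall_mem_range.2 fun y => (hη _).le⟩
  · simp [hξ, hη, Real.mul_self_sqrt hk]

end SchurKernels

/-! ### Minimal representations and weak continuity -/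

section Continuity

variable {H : Type v} [NormedAddCommGroup H] [InnerProductSpace ℂ H]

theorem topologicalClosure_span_range_eq_top_of_forall_inner_eq_zero [CompleteSpace H] {α : Type*}
    {f : α → H} (h : ∀ w, (∀ x, ⟪f x, w⟫_ℂ = 0) → w = 0) :
    (Submodule.span ℂ (Set.range f)).topologicalClosure = ⊤ := by
  rw [Submodule.topologicalClosure_eq_top_iff, Submodule.eq_bot_iff]
  exact fun w hw => h w fun x => hw _ (Submodule.subset_span ⟨x, rfl⟩)

theorem eq_zero_of_mem_closure_span_range {α : Type*} {f : α → H} {w : H}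
    (hw : w ∈ (Submodule.span ℂ (Set.range f)).topologicalClosure)
    (h : ∀ x, ⟪f x, w⟫_ℂ = 0) : w = 0 := by
  have hle : Submodule.span ℂ (Set.range f) ≤ (ℂ ∙ w)ᗮ :=
    Submodule.span_le.2 <| Set.range_subset_iff.2 fun x =>
      Submodule.mem_orthogonal_singleton_iff_inner_left.2 (h x)
  exact inner_self_eq_zero.1 <| Submodule.mem_orthogonal_singleton_iff_inner_left.1 <|
    Submodule.topologicalClosure_minimal _ hle (Submodule.isClosed_orthogonal _) hw

/-- The subspace is the closed span of the orthogonal projections of `η` to the closed span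
of `ξ`. -/
theorem exists_submodule_forall_total [CompleteSpace H] {α β : Type*} (ξ : α → H) (η : β → H) :
    ∃ (U : Submodule ℂ H) (_ : CompleteSpace U),
      (∀ x y, ⟪U.orthogonalProjectionOnto (η y), U.orthogonalProjectionOnto (ξ x)⟫_ℂ =
        ⟪η y, ξ x⟫_ℂ) ∧
      (∀ w : U, (∀ x, ⟪U.orthogonalProjectionOnto (ξ x), w⟫_ℂ = 0) → w = 0) ∧
      ∀ w : U, (∀ y, ⟪U.orthogonalProjectionOnto (η y), w⟫_ℂ = 0) → w = 0 := by
  let V : Submodule ℂ H := (Submodule.span ℂ (Set.range ξ)).topologicalClosure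
  have hξV : ∀ x, ξ x ∈ V := fun x =>
    Submodule.le_topologicalClosure _ (Submodule.subset_span ⟨x, rfl⟩)
  have : CompleteSpace V := (Submodule.isClosed_topologicalClosure _).completeSpace_coe
  let ζ : β → H := fun y => V.starProjection (η y)
  let U : Submodule ℂ H := (Submodule.span ℂ (Set.range ζ)).topologicalClosure
  have : CompleteSpace U := (Submodule.isClosed_topologicalClosure _).completeSpace_coe
  have hζU : ∀ y, ζ y ∈ U := fun y =>
    Submodule.le_topologicalClosure _ (Submodule.subset_span ⟨y, rfl⟩)
  have hUV : U ≤ V := Submodule.topologicalClosure_minimal _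
    (Submodule.span_le.2 (Set.range_subset_iff.2 fun y => V.starProjection_apply_mem (η y)))
    (Submodule.isClosed_topologicalClosure _)
  have hV : ∀ v ∈ V, ∀ y, ⟪ζ y, v⟫_ℂ = ⟪η y, v⟫_ℂ := fun v hv y => by
    rw [Submodule.inner_starProjection_left_eq_right, Submodule.starProjection_eq_self_iff.2 hv]
  have hU : ∀ (w : U) v, ⟪U.orthogonalProjectionOnto v, w⟫_ℂ = ⟪v, (w : H)⟫_ℂ := fun w v =>
    Submodule.inner_orthogonalProjectionOnto_eq_of_mem_right w v
  have hηζ : ∀ y, U.orthogonalProjectionOnto (η y) = ⟨ζ y, hζU y⟩ := fun y =>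
    ext_inner_right ℂ fun w => by rw [hU, ← hV w (hUV w.2)]; rfl
  refine ⟨U, inferInstance, fun x y => ?_, fun w hw => ?_, fun w hw => ?_⟩
  · rw [hηζ, ← hV _ (hξV x)]
    exact Submodule.inner_orthogonalProjectionOnto_eq_of_mem_left ⟨ζ y, hζU y⟩ (ξ x)
  · exact Subtype.ext (eq_zero_of_mem_closure_span_range (hUV w.2) fun x => hU w _ ▸ hw x)
  · refine Subtype.ext (eq_zero_of_mem_closure_span_range w.2 fun y => ?_)
    rw [hV _ (hUV w.2), ← hU, hw]

variable {X : Type*} [TopologicalSpace X]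

theorem continuous_inner_of_dense {ξ : X → H} {C : ℝ} (hC : ∀ x, ‖ξ x‖ ≤ C) {D : Set H}
    (hD : ∀ v ∈ D, Continuous fun x => ⟪v, ξ x⟫_ℂ)
    (hd : (Submodule.span ℂ D).topologicalClosure = ⊤) (v : H) :
    Continuous fun x => ⟪v, ξ x⟫_ℂ := by
  have hspan : ∀ w ∈ Submodule.span ℂ D, Continuous fun x => ⟪w, ξ x⟫_ℂ := fun w hw => by
    induction hw using Submodule.span_induction with
    | mem w hw => exact hD w hw
    | zero => simpa only [inner_zero_left] using continuous_const
    | add w z _ _ hw hz =>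
      simp only [inner_add_left]
      exact hw.add hz
    | smul c w _ hw => simpa only [inner_smul_left] using hw.const_mul _
  refine continuous_of_uniform_approx_of_continuous fun U hU => ?_
  obtain ⟨ε, hε, hεU⟩ := Metric.mem_uniformity_dist.1 hU
  have hv : v ∈ closure (Submodule.span ℂ D : Set H) := by
    rw [← Submodule.topologicalClosure_coe, hd]
    trivial
  have hC' : 0 < |C| + 1 := by positivity
  obtain ⟨w, hw, hvw⟩ := Metric.mem_closure_iff.1 hv (ε / (|C| + 1)) (by positivity)
  refine ⟨_, hspan w hw, fun x => hεU ?_⟩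
  rw [dist_eq_norm, lt_div_iff₀ hC'] at hvw
  rw [dist_eq_norm, ← inner_sub_left]
  calc ‖⟪v - w, ξ x⟫_ℂ‖ ≤ ‖v - w‖ * ‖ξ x‖ := norm_inner_le_norm _ _
    _ ≤ ‖v - w‖ * (|C| + 1) := by gcongr; linarith [hC x, le_abs_self C]
    _ < ε := hvw

theorem tsum_lintegral_enorm_inner_sq_le [MeasurableSpace X] [OpensMeasurableSpace X]
    (μ : Measure X) {ξ : X → H} {C : ℝ} (hC : ∀ x, ‖ξ x‖ ≤ C) {ι : Type*} {e : ι → H}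
    (he : Orthonormal ℂ e) (hc : ∀ i, Continuous fun x => ⟪e i, ξ x⟫_ℂ) (U : Set X) :
    ∑' i, ∫⁻ y in U, ‖⟪e i, ξ y⟫_ℂ‖ₑ ^ 2 ∂μ ≤ ENNReal.ofReal (C ^ 2) * μ U := by
  rw [ENNReal.tsum_eq_iSup_sum]
  refine iSup_le fun s => ?_
  rw [← lintegral_finsetSum s fun i _ => (hc i).enorm.measurable.pow_const 2, ← setLIntegral_const]
  refine lintegral_mono fun y => ?_
  have hbessel : ∑ i ∈ s, ‖⟪e i, ξ y⟫_ℂ‖ ^ 2 ≤ C ^ 2 :=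
    (he.sum_inner_products_le (ξ y)).trans (pow_le_pow_left₀ (norm_nonneg _) (hC y) 2)
  simp only [← ofReal_norm, ← ENNReal.ofReal_pow (norm_nonneg _)]
  rw [← ENNReal.ofReal_sum_of_nonneg fun i _ => by positivity]
  exact ENNReal.ofReal_le_ofReal hbessel

theorem locallyCountable_inner [MeasurableSpace X] [OpensMeasurableSpace X] (μ : Measure X)
    [IsLocallyFiniteMeasure μ] [μ.IsOpenPosMeasure] {ξ : X → H} {C : ℝ} (hC : ∀ x, ‖ξ x‖ ≤ C)
    {ι : Type*} {e : ι → H} (he : Orthonormal ℂ e) (hc : ∀ i, Continuous fun x => ⟪e i, ξ x⟫_ℂ) :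
    LocallyCountable fun i x => ⟪e i, ξ x⟫_ℂ := by
  intro x
  obtain ⟨U, hxU, hUo, hU⟩ := μ.exists_isOpen_measure_lt_top x
  refine ⟨U, hUo.mem_nhds hxU, ?_⟩
  have hsum := ne_top_of_le_ne_top (ENNReal.mul_ne_top ENNReal.ofReal_ne_top hU.ne)
    (tsum_lintegral_enorm_inner_sq_le μ hC he hc U)
  refine (Summable.countable_support_ennreal hsum).mono ?_
  rintro i ⟨y, hy, hne⟩
  rw [Function.mem_support, ← pos_iff_ne_zero,
    setLIntegral_pos_iff ((hc i).enorm.measurable.pow_const 2)]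
  have hopen : IsOpen (U ∩ {z | ⟪e i, ξ z⟫_ℂ ≠ 0}) := hUo.inter (isOpen_ne.preimage (hc i))
  refine (hopen.measure_pos μ ⟨y, hy, hne⟩).trans_le (measure_mono fun z hz => ⟨?_, hz.1⟩)
  exact pow_ne_zero 2 (enorm_ne_zero.2 hz.2)

theorem hasGoodCoordinates_of_continuous_inner [MeasurableSpace X] [OpensMeasurableSpace X]
    (μ : Measure X) [IsLocallyFiniteMeasure μ] [μ.IsOpenPosMeasure] {ξ : X → H}
    (hb : BddAbove (Set.range fun x => ‖ξ x‖)) (hc : ∀ v, Continuous fun x => ⟪v, ξ x⟫_ℂ)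
    {ι : Type*} (e : HilbertBasis ι ℂ H) : HasGoodCoordinates e ξ :=
  ⟨fun i => hc (e i), locallyCountable_inner μ (le_ciSup hb) e.orthonormal fun i => hc (e i)⟩

variable {G : Type*} [Group G] {φ : G → ℂ} {k : ℝ} {ξ η : G → H}

theorem IsGilbertPair.orthogonalProjectionOnto (h : IsGilbertPair φ k ξ η) (U : Submodule ℂ H)
    [CompleteSpace U] (hU : ∀ x y, ⟪U.orthogonalProjectionOnto (η y),
      U.orthogonalProjectionOnto (ξ x)⟫_ℂ = ⟪η y, ξ x⟫_ℂ) :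
    IsGilbertPair φ k (fun x => U.orthogonalProjectionOnto (ξ x))
      fun y => U.orthogonalProjectionOnto (η y) := by
  obtain ⟨hξ, hη, hφ, hk⟩ := h
  have hle : ∀ v, ‖U.orthogonalProjectionOnto v‖ ≤ ‖v‖ := U.norm_orthogonalProjectionOnto_apply_le
  refine ⟨hξ.range_mono _ fun x => hle _, hη.range_mono _ fun y => hle _,
    fun x y => (hφ x y).trans (hU x y).symm, le_trans ?_ hk⟩
  exact mul_le_mul (ciSup_mono hξ fun x => hle _) (ciSup_mono hη fun y => hle _)
    (Real.iSup_nonneg fun _ => norm_nonneg _) (Real.iSup_nonneg fun _ => norm_nonneg _)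

variable [CompleteSpace H] [TopologicalSpace G] [IsTopologicalGroup G]

theorem IsGilbertPair.exists_continuous_inner (h : IsGilbertPair φ k ξ η) (hφ : Continuous φ) :
    ∃ (H' : Type v) (_ : NormedAddCommGroup H') (_ : InnerProductSpace ℂ H') (_ : CompleteSpace H')
      (ξ' η' : G → H'), IsGilbertPair φ k ξ' η' ∧
        (∀ v, Continuous fun x => ⟪v, ξ' x⟫_ℂ) ∧ ∀ v, Continuous fun y => ⟪v, η' y⟫_ℂ := by
  obtain ⟨U, _, hin, hξ, hη⟩ := exists_submodule_forall_total ξ η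
  have h' := h.orthogonalProjectionOnto U hin
  refine ⟨U, inferInstance, inferInstance, inferInstance, _, _, h',
    continuous_inner_of_dense (le_ciSup h'.1) ?_
      (topologicalClosure_span_range_eq_top_of_forall_inner_eq_zero hη),
    continuous_inner_of_dense (le_ciSup h'.2.1) ?_
      (topologicalClosure_span_range_eq_top_of_forall_inner_eq_zero hξ)⟩
  · rintro _ ⟨y, rfl⟩
    simp only [← h'.2.2.1]
    fun_prop
  · rintro _ ⟨x, rfl⟩
    have hconj : ∀ y, ⟪U.orthogonalProjectionOnto (ξ x), U.orthogonalProjectionOnto (η y)⟫_ℂ =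
        conj (φ (y⁻¹ * x)) := fun y => by rw [h'.2.2.1, inner_conj_symm]
    simp only [hconj]
    exact Complex.continuous_conj.comp (by fun_prop)

theorem IsGilbertPair.exists_hasGoodCoordinates [LocallyCompactSpace G] [MeasurableSpace G]
    [BorelSpace G] (μ : Measure G) [μ.IsHaarMeasure] (h : IsGilbertPair φ k ξ η)
    (hφ : Continuous φ) :
    ∃ (H' : Type v) (_ : NormedAddCommGroup H') (_ : InnerProductSpace ℂ H') (_ : CompleteSpace H')
      (ξ' η' : G → H'), IsGilbertPair φ k ξ' η' ∧ ∀ (ι : Type v) (e : HilbertBasis ι ℂ H'),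
        HasGoodCoordinates e ξ' ∧ HasGoodCoordinates e η' := by
  obtain ⟨H', _, _, _, ξ', η', h', hξ, hη⟩ := h.exists_continuous_inner hφ
  exact ⟨H', inferInstance, inferInstance, inferInstance, ξ', η', h', fun ι e =>
    ⟨hasGoodCoordinates_of_continuous_inner μ h'.1 hξ e,
      hasGoodCoordinates_of_continuous_inner μ h'.2.1 hη e⟩⟩

end Continuity

/-! ### Amplifications of operators to Hilbert sums -/

section SquareSummable

variable {H κ : Type*} [NormedAddCommGroup H]

theorem sum_sq_le_norm_sq (f : ℓ²(κ, H)) (s : Finset κ) : ∑ i ∈ s, ‖f i‖ ^ 2 ≤ ‖f‖ ^ 2 := by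
  simpa using lp.sum_rpow_le_norm_rpow (p := 2) (by simp) f s

theorem norm_le_of_forall_sum_sq_le {f : ℓ²(κ, H)} {C : ℝ} (hC : 0 ≤ C)
    (h : ∀ s : Finset κ, ∑ i ∈ s, ‖f i‖ ^ 2 ≤ C ^ 2) : ‖f‖ ≤ C :=
  lp.norm_le_of_forall_sum_le (by simp) hC fun s => by simpa using h s

theorem memℓp_two_of_forall_sum_sq_le {f : κ → H} {C : ℝ}
    (h : ∀ s : Finset κ, ∑ i ∈ s, ‖f i‖ ^ 2 ≤ C) : Memℓp f 2 :=
  memℓp_gen' (C := C) fun s => by simpa using h s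

theorem memℓp_two_iff_summable_sq {f : κ → H} : Memℓp f 2 ↔ Summable fun i => ‖f i‖ ^ 2 := by
  rw [memℓp_gen_iff (by simp)]
  simp

theorem summable_norm_sq (f : ℓ²(κ, H)) : Summable fun i => ‖f i‖ ^ 2 :=
  memℓp_two_iff_summable_sq.1 f.2

end SquareSummable

section Amplification

variable {H K : Type*} [NormedAddCommGroup H] [InnerProductSpace ℂ H]
  [NormedAddCommGroup K] [InnerProductSpace ℂ K] {κ κ' : Type*}

theorem sum_norm_sq_apply_le (V : H →L[ℂ] ℓ²(κ, K)) (s : Finset κ) (v : H) :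
    ∑ i ∈ s, ‖V v i‖ ^ 2 ≤ (‖V‖ * ‖v‖) ^ 2 :=
  (sum_sq_le_norm_sq (V v) s).trans (pow_le_pow_left₀ (norm_nonneg _) (V.le_opNorm v) 2)

theorem memℓp_two_uncurry_apply (U : H →L[ℂ] ℓ²(κ, K)) (E : ℓ²(κ', H)) :
    Memℓp (fun p : κ' × κ => U (E p.1) p.2) 2 :=
  memℓp_two_iff_summable_sq.2 <| summable_prod_of_nonneg (fun _ => sq_nonneg _) |>.2
    ⟨fun n => summable_norm_sq (U (E n)),
      ((summable_norm_sq E).mul_left (‖U‖ ^ 2)).of_nonneg_of_le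
        (fun _ => tsum_nonneg fun _ => sq_nonneg _) fun n =>
          ((summable_norm_sq (U (E n))).tsum_le_of_sum_le fun s =>
            sum_norm_sq_apply_le U s (E n)).trans_eq (mul_pow _ _ _)⟩

/-- The column operator `v ↦ (Aᵢ v)ᵢ` with values in a Hilbert sum. -/
noncomputable def column (A : κ → H →L[ℂ] K) (C : ℝ) (hC : 0 ≤ C)
    (h : ∀ (s : Finset κ) (v : H), ∑ i ∈ s, ‖A i v‖ ^ 2 ≤ (C * ‖v‖) ^ 2) : H →L[ℂ] ℓ²(κ, K) :=
  LinearMap.mkContinuous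
    { toFun := fun v => ⟨fun i => A i v, memℓp_two_of_forall_sum_sq_le fun s => h s v⟩
      map_add' := fun v w => lp.ext (funext fun i => map_add (A i) v w)
      map_smul' := fun c v => lp.ext (funext fun i => map_smul (A i) c v) } C
    fun v => norm_le_of_forall_sum_sq_le (by positivity) fun s => h s v

theorem norm_column_le (A : κ → H →L[ℂ] K) (C : ℝ) (hC : 0 ≤ C)
    (h : ∀ (s : Finset κ) (v : H), ∑ i ∈ s, ‖A i v‖ ^ 2 ≤ (C * ‖v‖) ^ 2) :
    ‖column A C hC h‖ ≤ C :=
  LinearMap.mkContinuous_norm_le _ hC _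

variable (κ) in
/-- The amplification `T ⊗ 1` of an operator to a Hilbert sum. -/
noncomputable def ampl (T : H →L[ℂ] K) : ℓ²(κ, H) →L[ℂ] ℓ²(κ, K) :=
  column (fun i => T ∘L lp.evalCLM ℂ (fun _ => H) 2 i) ‖T‖ (norm_nonneg _) fun s v => by
    rw [mul_pow]
    refine le_trans ?_ (mul_le_mul_of_nonneg_left (sum_sq_le_norm_sq v s) (sq_nonneg _))
    rw [Finset.mul_sum]
    refine Finset.sum_le_sum fun i _ => ?_
    rw [← mul_pow]
    exact pow_le_pow_left₀ (norm_nonneg _) (T.le_opNorm _) 2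

@[simp]
theorem ampl_apply (T : H →L[ℂ] K) (v : ℓ²(κ, H)) (i : κ) : ampl κ T v i = T (v i) := rfl

theorem ampl_add (S T : H →L[ℂ] K) : ampl κ (S + T) = ampl κ S + ampl κ T := rfl

theorem ampl_smul (c : ℂ) (T : H →L[ℂ] K) : ampl κ (c • T) = c • ampl κ T := rfl

theorem norm_ampl_le (T : H →L[ℂ] K) : ‖ampl κ T‖ ≤ ‖T‖ := norm_column_le _ _ _ _

theorem ampl_single [DecidableEq κ] (T : H →L[ℂ] K) (i : κ) (x : H) :
    ampl κ T (lp.single 2 i x) = lp.single 2 i (T x) := by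
  ext j
  rw [ampl_apply, lp.single_apply, lp.single_apply]
  obtain rfl | h := eq_or_ne j i
  · simp
  · simp [h]

theorem hasSum_inner_ampl (T : H →L[ℂ] K) (G : ℓ²(κ, K)) (F : ℓ²(κ, H)) :
    HasSum (fun i => ⟪G i, T (F i)⟫_ℂ) ⟪G, ampl κ T F⟫_ℂ :=
  lp.hasSum_inner G (ampl κ T F)

theorem adjoint_ampl [CompleteSpace H] [CompleteSpace K] (T : H →L[ℂ] K) :
    ContinuousLinearMap.adjoint (ampl κ T) = ampl κ (ContinuousLinearMap.adjoint T) := by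
  refine ((ContinuousLinearMap.eq_adjoint_iff _ _).2 fun x y => ?_).symm
  refine (lp.hasSum_inner (ampl κ (ContinuousLinearMap.adjoint T) x) y).unique ?_
  simpa only [ampl_apply, ContinuousLinearMap.adjoint_inner_left] using hasSum_inner_ampl T x y

/-- The juxtaposition of two elements of Hilbert sums. -/
noncomputable def sumElim (F : ℓ²(κ, H)) (F' : ℓ²(κ', H)) : ℓ²(κ ⊕ κ', H) :=
  ⟨Sum.elim F F', memℓp_two_iff_summable_sq.2
    ((summable_norm_sq F).hasSum.sum (f := fun i => ‖Sum.elim F F' i‖ ^ 2)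
      (summable_norm_sq F').hasSum).summable⟩

theorem inner_ampl_sumElim (T : H →L[ℂ] H) (G F : ℓ²(κ, H)) (G' F' : ℓ²(κ', H)) :
    ⟪sumElim G G', ampl _ T (sumElim F F')⟫_ℂ = ⟪G, ampl κ T F⟫_ℂ + ⟪G', ampl κ' T F'⟫_ℂ :=
  (hasSum_inner_ampl T (sumElim G G') (sumElim F F')).unique <|
    HasSum.sum (hasSum_inner_ampl T G F) (hasSum_inner_ampl T G' F')

theorem apply_apply_of_commute {A B : H →L[ℂ] H} (h : Commute A B) (x : H) :
    A (B x) = B (A x) :=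
  DFunLike.congr_fun h.eq x

theorem commute_ampl_of_mem_centralizer_centralizer {S : Set (H →L[ℂ] H)}
    {R : ℓ²(κ, H) →L[ℂ] ℓ²(κ, H)} (hR : ∀ s ∈ S, Commute R (ampl κ s)) {T : H →L[ℂ] H}
    (hT : T ∈ S.centralizer.centralizer) : Commute R (ampl κ T) := by
  classical
  have hsingle : ∀ A : H →L[ℂ] H, Commute R (ampl κ A) ↔ ∀ i j x,
      R (lp.single 2 j (A x)) i = A (R (lp.single 2 j x) i) := fun A => by
    refine ⟨fun h i j x => ?_, fun h => lp.ext_continuousLinearMap (by simp) fun j => ?_⟩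
    · rw [← ampl_single, apply_apply_of_commute h, ampl_apply]
    · ext x i
      exact (congrArg (fun v => R v i) (ampl_single A j x)).trans (h i j x)
  refine (hsingle T).2 fun i j x => ?_
  have hentry : lp.evalCLM ℂ (fun _ => H) 2 i ∘L R ∘L
      lp.singleContinuousLinearMap ℂ (fun _ => H) 2 j ∈ S.centralizer := fun s hs => by
    ext x
    exact ((hsingle s).1 (hR s hs) i j x).symm
  exact DFunLike.congr_fun (hT _ hentry) x

end Amplification

section Bicommutant

variable {H : Type*} [NormedAddCommGroup H] [InnerProductSpace ℂ H] [CompleteSpace H]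
  {κ κ' : Type*}

theorem commute_starProjection {U : Submodule ℂ H} [CompleteSpace U] {A : H →L[ℂ] H}
    (hA : ∀ u ∈ U, A u ∈ U) (hA' : ∀ u ∈ U, ContinuousLinearMap.adjoint A u ∈ U) :
    Commute U.starProjection A := by
  refine (ContinuousLinearMap.IsIdempotentElem.commute_iff
    U.isIdempotentElem_starProjection).2 ⟨?_, ?_⟩
  · rwa [U.range_starProjection]
  · rw [U.ker_starProjection]
    exact ContinuousLinearMap.orthogonal_mem_invtSubmodule hA'

variable {S : Submonoid (H →L[ℂ] H)} (hS : ∀ s ∈ S, star s ∈ S) {T : H →L[ℂ] H}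
  (hT : T ∈ (generatedVonNeumannAlgebra (S : Set (H →L[ℂ] H))).toStarSubalgebra)
include hS hT

/-- The main step in the proof of the bicommutant theorem. -/
theorem ampl_mem_closure_span (F : ℓ²(κ, H)) :
    ampl κ T F ∈ (Submodule.span ℂ
      ((fun s => ampl κ s F) '' (S : Set (H →L[ℂ] H)))).topologicalClosure := by
  let U := (Submodule.span ℂ ((fun s => ampl κ s F) '' (S : Set (H →L[ℂ] H)))).topologicalClosure
  have : CompleteSpace U := (Submodule.isClosed_topologicalClosure _).completeSpace_coe
  have hinv : ∀ s ∈ S, ∀ u ∈ U, ampl κ s u ∈ U := fun s hs => by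
    refine Submodule.topologicalClosure_mem_invtSubmodule (Submodule.span_le.2 ?_)
    rintro _ ⟨t, ht, rfl⟩
    exact Submodule.subset_span ⟨s * t, mul_mem hs ht, rfl⟩
  have hcomm : ∀ s ∈ (S : Set (H →L[ℂ] H)) ∪ star (S : Set (H →L[ℂ] H)),
      Commute U.starProjection (ampl κ s) := by
    intro s hs
    have hs' : s ∈ S := hs.elim id fun h => star_star s ▸ hS _ h
    exact commute_starProjection (hinv s hs') (adjoint_ampl (κ := κ) s ▸ hinv _ (hS s hs'))
  have hF : U.starProjection F = F := Submodule.starProjection_eq_self_iff.2 <|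
    Submodule.le_topologicalClosure _ (Submodule.subset_span ⟨1, one_mem S, rfl⟩)
  refine Submodule.starProjection_eq_self_iff.1 ?_
  rw [apply_apply_of_commute (commute_ampl_of_mem_centralizer_centralizer hcomm hT), hF]

theorem inner_ampl_eq_zero {G F : ℓ²(κ, H)} (h : ∀ s ∈ S, ⟪G, ampl κ s F⟫_ℂ = 0) :
    ⟪G, ampl κ T F⟫_ℂ = 0 := by
  have hle : Submodule.span ℂ ((fun s => ampl κ s F) '' (S : Set (H →L[ℂ] H))) ≤ (ℂ ∙ G)ᗮ :=
    Submodule.span_le.2 <| Set.image_subset_iff.2 fun s hs =>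
      Submodule.mem_orthogonal_singleton_iff_inner_right.2 (h s hs)
  exact Submodule.mem_orthogonal_singleton_iff_inner_right.1 <|
    Submodule.topologicalClosure_minimal _ hle (Submodule.isClosed_orthogonal _)
      (ampl_mem_closure_span hS hT F)

theorem inner_ampl_eq {G F : ℓ²(κ, H)} {G' F' : ℓ²(κ', H)}
    (h : ∀ s ∈ S, ⟪G, ampl κ s F⟫_ℂ = ⟪G', ampl κ' s F'⟫_ℂ) :
    ⟪G, ampl κ T F⟫_ℂ = ⟪G', ampl κ' T F'⟫_ℂ := by
  have hsum : ∀ A, ⟪sumElim G (-G'), ampl _ A (sumElim F F')⟫_ℂ =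
      ⟪G, ampl κ A F⟫_ℂ - ⟪G', ampl κ' A F'⟫_ℂ := fun A => by
    rw [inner_ampl_sumElim, inner_neg_left, sub_eq_add_neg]
  have := inner_ampl_eq_zero hS hT fun s hs => (hsum s).trans (sub_eq_zero.2 (h s hs))
  rwa [hsum, sub_eq_zero] at this

end Bicommutant

section Predual

variable {H : Type*} [NormedAddCommGroup H] [InnerProductSpace ℂ H] [CompleteSpace H]
  {κ : Type*}

theorem InPredual.exists_lp {M : VonNeumannAlgebra H} {ω : M.toStarSubalgebra →ₗ[ℂ] ℂ}
    (hω : InPredual M ω) : ∃ F G : ℓ²(ℕ, H),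
      ∀ T : M.toStarSubalgebra, ω T = ⟪G, ampl ℕ (T : H →L[ℂ] H) F⟫_ℂ := by
  obtain ⟨f, g, hf, hg, h⟩ := hω
  exact ⟨⟨f, memℓp_two_iff_summable_sq.2 hf⟩, ⟨g, memℓp_two_iff_summable_sq.2 hg⟩,
    fun T => (h T).unique (hasSum_inner_ampl _ _ _)⟩

/-- Only countably many coordinates of `F` contribute; they are enumerated by natural numbers. -/
theorem inPredual_of_lp {M : VonNeumannAlgebra H} {ω : M.toStarSubalgebra →ₗ[ℂ] ℂ}
    (F G : ℓ²(κ, H))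
    (h : ∀ T : M.toStarSubalgebra, ω T = ⟪G, ampl κ (T : H →L[ℂ] H) F⟫_ℂ) : InPredual M ω := by
  let s : Set κ := Function.support fun i => ‖F i‖ ^ 2
  have : Countable s := (summable_norm_sq F).countable_support.to_subtype
  obtain ⟨j, hj⟩ := exists_injective_nat s
  let p : ℕ → H × H := Function.extend j (fun i : s => (F i, G i)) 0
  have hp : ∀ {E : Type _} [Zero E] (c : H × H → E), c 0 = 0 →
      (fun n => c (p n)) = Function.extend j (fun i : s => c (F i, G i)) 0 := fun c hc => by
    funext n
    refine (Function.apply_extend c j _ n).trans ?_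
    congr 1
    exact funext fun _ => hc
  have hsum : ∀ (c : H × H → ℝ), c 0 = 0 → Summable (fun i => c (F i, G i)) →
      Summable fun n => c (p n) := fun c hc hs => by
    rw [hp c hc]
    exact ((hasSum_extend_zero hj).2 (hs.subtype s).hasSum).summable
  refine ⟨fun n => (p n).1, fun n => (p n).2,
    hsum (fun q => ‖q.1‖ ^ 2) (by simp) (summable_norm_sq F),
    hsum (fun q => ‖q.2‖ ^ 2) (by simp) (summable_norm_sq G), fun T => ?_⟩
  rw [hp (fun q => ⟪q.2, (T : H →L[ℂ] H) q.1⟫_ℂ) (by simp), hasSum_extend_zero hj, h]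
  have hsupp : (Function.support fun i => ⟪G i, (T : H →L[ℂ] H) (F i)⟫_ℂ) ⊆ s := fun i hi => by
    have hF : F i ≠ 0 := fun hF => hi (by simp only [hF, map_zero, inner_zero_right])
    simpa [s] using hF
  exact (hasSum_subtype_iff_of_support_subset hsupp).2 (hasSum_inner_ampl (T : H →L[ℂ] H) G F)

theorem InPredual.eq_of_eqOn {S : Submonoid (H →L[ℂ] H)} (hS : ∀ s ∈ S, star s ∈ S)
    {ω ω' : (generatedVonNeumannAlgebra (S : Set (H →L[ℂ] H))).toStarSubalgebra →ₗ[ℂ] ℂ}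
    (hω : InPredual _ ω) (hω' : InPredual _ ω')
    (h : ∀ s (hs : s ∈ S), ω ⟨s, mem_generatedVonNeumannAlgebra hs⟩ =
      ω' ⟨s, mem_generatedVonNeumannAlgebra hs⟩) : ω = ω' := by
  obtain ⟨F, G, hFG⟩ := hω.exists_lp
  obtain ⟨F', G', hFG'⟩ := hω'.exists_lp
  ext T
  rw [hFG, hFG']
  refine inner_ampl_eq hS T.2 fun s hs => ?_
  simpa only [hFG, hFG'] using h s hs

end Predual

section Shuffle

variable {H K : Type*} [NormedAddCommGroup H] [InnerProductSpace ℂ H]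
  [NormedAddCommGroup K] [InnerProductSpace ℂ K] {ι : Type*}

/-- The amplification `U ⊗ 1` of an operator `U : H → ℓ²(ι, K)` to `Hⁿ`, followed by the exchange
of the two summation indices. -/
noncomputable def shuffle (n : ℕ) (U : H →L[ℂ] ℓ²(ι, K)) :
    PiLp 2 (fun _ : Fin n => H) →L[ℂ] ℓ²(ι, PiLp 2 (fun _ : Fin n => K)) :=
  column (fun k => ((PiLp.continuousLinearEquiv 2 ℂ (fun _ : Fin n => K)).symm :
      (Fin n → K) →L[ℂ] PiLp 2 (fun _ : Fin n => K)) ∘L ContinuousLinearMap.pi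
      fun j => lp.evalCLM ℂ (fun _ => K) 2 k ∘L U ∘L PiLp.proj (𝕜 := ℂ) 2 (fun _ : Fin n => H) j)
    ‖U‖ U.opNorm_nonneg fun s v => by
      rw [mul_pow, PiLp.norm_sq_eq_of_L2, Finset.mul_sum]
      simp only [PiLp.norm_sq_eq_of_L2]
      rw [Finset.sum_comm]
      refine Finset.sum_le_sum fun j _ => (sum_norm_sq_apply_le U s (v j)).trans_eq ?_
      rw [mul_pow]

theorem shuffle_apply {n : ℕ} (U : H →L[ℂ] ℓ²(ι, K)) (v : PiLp 2 (fun _ : Fin n => H)) (k : ι)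
    (j : Fin n) : shuffle n U v k j = U (v j) k := rfl

theorem norm_shuffle_le (n : ℕ) (U : H →L[ℂ] ℓ²(ι, K)) : ‖shuffle n U‖ ≤ ‖U‖ :=
  norm_column_le _ _ _ _

end Shuffle

section Compression

variable {H K : Type*} [NormedAddCommGroup H] [InnerProductSpace ℂ H] [CompleteSpace H]
  [NormedAddCommGroup K] [InnerProductSpace ℂ K] [CompleteSpace K] {ι : Type*}

/-- The map `T ↦ W* (T ⊗ 1) V`, the Stinespring form of a normal completely bounded map. -/
noncomputable def compression (V W : H →L[ℂ] ℓ²(ι, K)) : (K →L[ℂ] K) →ₗ[ℂ] (H →L[ℂ] H) where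
  toFun T := ContinuousLinearMap.adjoint W ∘L ampl ι T ∘L V
  map_add' S T := by
    rw [ampl_add, ContinuousLinearMap.add_comp, ContinuousLinearMap.comp_add]
  map_smul' c T := by
    rw [ampl_smul, ContinuousLinearMap.smul_comp, ContinuousLinearMap.comp_smul, RingHom.id_apply]

theorem inner_compression (V W : H →L[ℂ] ℓ²(ι, K)) (T : K →L[ℂ] K) (g f : H) :
    ⟪g, compression V W T f⟫_ℂ = ⟪W g, ampl ι T (V f)⟫_ℂ :=
  ContinuousLinearMap.adjoint_inner_right W g _

theorem matrixOperator_compression {n : ℕ} (V W : H →L[ℂ] ℓ²(ι, K))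
    (a : Matrix (Fin n) (Fin n) (K →L[ℂ] K)) :
    matrixOperator (a.map (compression V W)) =
      compression (shuffle n V) (shuffle n W) (matrixOperator a) := by
  ext1 v
  refine ext_inner_left ℂ fun w => ?_
  rw [inner_compression, PiLp.inner_apply]
  simp only [matrixOperator_apply, Matrix.map_apply, inner_sum, inner_compression]
  have hsum : HasSum (fun k => ∑ i, ∑ j, ⟪W (w i) k, a i j (V (v j) k)⟫_ℂ)
      (∑ i, ∑ j, ⟪W (w i), ampl ι (a i j) (V (v j))⟫_ℂ) :=
    hasSum_sum fun i _ => hasSum_sum fun j _ => hasSum_inner_ampl _ _ _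
  refine hsum.unique ?_
  simpa only [PiLp.inner_apply, matrixOperator_apply, shuffle_apply, inner_sum] using
    hasSum_inner_ampl (matrixOperator a) (shuffle n W w) (shuffle n V v)

theorem norm_compression_le (V W : H →L[ℂ] ℓ²(ι, K)) (T : K →L[ℂ] K) :
    ‖compression V W T‖ ≤ ‖W‖ * ‖T‖ * ‖V‖ := by
  refine (ContinuousLinearMap.opNorm_comp_le _ _).trans ?_
  rw [LinearIsometryEquiv.norm_map, mul_assoc]
  refine mul_le_mul_of_nonneg_left ?_ W.opNorm_nonneg
  refine (ContinuousLinearMap.opNorm_comp_le _ _).trans ?_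
  exact mul_le_mul_of_nonneg_right (norm_ampl_le T) V.opNorm_nonneg

theorem norm_matrixOperator_compression_le {n : ℕ} (V W : H →L[ℂ] ℓ²(ι, K))
    (a : Matrix (Fin n) (Fin n) (K →L[ℂ] K)) :
    ‖matrixOperator (a.map (compression V W))‖ ≤ ‖W‖ * ‖matrixOperator a‖ * ‖V‖ := by
  rw [matrixOperator_compression]
  refine (norm_compression_le _ _ _).trans ?_
  gcongr
  exacts [norm_shuffle_le n W, norm_shuffle_le n V]

end Compression

section NormalMaps

variable {H : Type*} [NormedAddCommGroup H] [InnerProductSpace ℂ H] [CompleteSpace H] {ι : Type*}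

theorem compression_mem {S : Submonoid (H →L[ℂ] H)} (hS : ∀ s ∈ S, star s ∈ S)
    (V W : H →L[ℂ] ℓ²(ι, H))
    (h : ∀ s ∈ S, compression V W s ∈
      (generatedVonNeumannAlgebra (S : Set (H →L[ℂ] H))).toStarSubalgebra)
    {T : H →L[ℂ] H} (hT : T ∈ (generatedVonNeumannAlgebra (S : Set (H →L[ℂ] H))).toStarSubalgebra) :
    compression V W T ∈ (generatedVonNeumannAlgebra (S : Set (H →L[ℂ] H))).toStarSubalgebra := by
  intro R hR
  have hleft : ∀ (T : H →L[ℂ] H) (g f : H), ⟪g, R (compression V W T f)⟫_ℂ =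
      ⟪W (ContinuousLinearMap.adjoint R g), ampl ι T (V f)⟫_ℂ := fun T g f => by
    rw [← inner_compression, ContinuousLinearMap.adjoint_inner_left]
  ext f
  refine ext_inner_left ℂ fun g => ((hleft T g f).trans ?_).trans
    (inner_compression V W T g (R f)).symm
  refine inner_ampl_eq hS hT fun s hs => ?_
  have hcomm : Commute R (compression V W s) := h s hs R hR
  rw [← hleft, ← inner_compression, apply_apply_of_commute hcomm]

/-- The restriction of a compression to a von Neumann algebra which it leaves invariant. -/
noncomputable def restrictCompression (M : VonNeumannAlgebra H) (V W : H →L[ℂ] ℓ²(ι, H))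
    (h : ∀ T ∈ M.toStarSubalgebra, compression V W T ∈ M.toStarSubalgebra) :
    M.toStarSubalgebra →ₗ[ℂ] M.toStarSubalgebra where
  toFun T := ⟨compression V W T, h T T.2⟩
  map_add' S T := Subtype.ext (map_add (compression V W) (S : H →L[ℂ] H) T)
  map_smul' c T := Subtype.ext (map_smul (compression V W) c (T : H →L[ℂ] H))

theorem InPredual.comp_restrictCompression {M : VonNeumannAlgebra H}
    {ω : M.toStarSubalgebra →ₗ[ℂ] ℂ} (hω : InPredual M ω) (V W : H →L[ℂ] ℓ²(ι, H))
    (h : ∀ T ∈ M.toStarSubalgebra, compression V W T ∈ M.toStarSubalgebra) :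
    InPredual M (ω ∘ₗ restrictCompression M V W h) := by
  obtain ⟨F, G, hFG⟩ := hω.exists_lp
  refine inPredual_of_lp ⟨_, memℓp_two_uncurry_apply V F⟩ ⟨_, memℓp_two_uncurry_apply W G⟩
    fun T => ?_
  rw [LinearMap.comp_apply, hFG]
  refine (hasSum_inner_ampl _ G F).unique ((hasSum_inner_ampl (T : H →L[ℂ] H) _ _).prod_fiberwise
    fun n => ?_)
  have hn := hasSum_inner_ampl (T : H →L[ℂ] H) (W (G n)) (V (F n))
  rwa [← inner_compression] at hn

theorem cbNorm_restrictCompression_le (M : VonNeumannAlgebra H) (V W : H →L[ℂ] ℓ²(ι, H))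
    (h : ∀ T ∈ M.toStarSubalgebra, compression V W T ∈ M.toStarSubalgebra) :
    cbNorm M (restrictCompression M V W h) ≤ ENNReal.ofReal (‖W‖ * ‖V‖) := by
  refine iSup_le fun n => iSup_le fun a => iSup_le fun ha => ?_
  rw [← ofReal_norm]
  refine ENNReal.ofReal_le_ofReal ?_
  refine (norm_matrixOperator_compression_le V W (a.map fun T => (T : H →L[ℂ] H))).trans ?_
  exact mul_le_mul_of_nonneg_right (mul_le_of_le_one_right W.opNorm_nonneg ha) V.opNorm_nonneg

end NormalMaps

/-! ### Multiplication operators on `L²` -/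

section Multiplication

variable {X : Type*} [MeasurableSpace X] {μ : Measure X} {ι : Type*}

theorem norm_sq_eq_integral (f : Lp ℂ 2 μ) : ‖f‖ ^ 2 = ∫ y, ‖f y‖ ^ 2 ∂μ := by
  rw [@norm_sq_eq_re_inner ℂ, L2.inner_def, ← integral_re (L2.integrable_inner f f)]
  simp only [← norm_sq_eq_re_inner]

theorem integrable_norm_sq (f : Lp ℂ 2 μ) : Integrable (fun y => ‖f y‖ ^ 2) μ :=
  (Lp.memLp f).integrable_norm_pow two_ne_zero

theorem integral_norm_inner_le (f g : Lp ℂ 2 μ) :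
    ∫ y, ‖⟪f y, g y⟫_ℂ‖ ∂μ ≤ ‖f‖ ^ 2 + ‖g‖ ^ 2 := by
  rw [norm_sq_eq_integral, norm_sq_eq_integral, ← integral_add (integrable_norm_sq f)
    (integrable_norm_sq g)]
  refine integral_mono (L2.integrable_inner f g).norm
    ((integrable_norm_sq f).add (integrable_norm_sq g)) fun y => ?_
  refine (norm_inner_le_norm (f y) (g y)).trans ?_
  have := two_mul_le_add_sq ‖f y‖ ‖g y‖
  have := mul_nonneg (norm_nonneg (f y)) (norm_nonneg (g y))
  change _ ≤ ‖f y‖ ^ 2 + ‖g y‖ ^ 2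
  linarith

theorem inner_eq_integral_tsum {s : Set ι} (hs : s.Countable) {F G : ℓ²(ι, Lp ℂ 2 μ)}
    (hF : ∀ i ∉ s, F i = 0) : ⟪G, F⟫_ℂ = ∫ y, ∑' i : s, ⟪G i y, F i y⟫_ℂ ∂μ := by
  have := hs.to_subtype
  have hsummable : Summable fun i : s => ∫ y, ‖⟪G i y, F i y⟫_ℂ‖ ∂μ :=
    (((summable_norm_sq G).add (summable_norm_sq F)).subtype s).of_nonneg_of_le
      (fun _ => integral_nonneg fun _ => norm_nonneg _) fun i => integral_norm_inner_le (G i) (F i)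
  have hsupp : (Function.support fun i => ⟪G i, F i⟫_ℂ) ⊆ s := fun i hi => by
    by_contra his
    exact hi (by simp only [hF i his, inner_zero_right])
  exact ((hasSum_subtype_iff_of_support_subset hsupp).2 (lp.hasSum_inner G F)).unique
    (hasSum_integral_of_summable_integral_norm (fun i => L2.integrable_inner _ _) hsummable)

/-- The operator of multiplication by an essentially bounded function on `L²`. -/
noncomputable def mulOp {m : X → ℂ} (hm : MemLp m ∞ μ) : Lp ℂ 2 μ →L[ℂ] Lp ℂ 2 μ :=
  (ContinuousLinearMap.mul ℂ ℂ).holderL μ ∞ 2 2 hm.toLp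

theorem coeFn_mulOp {m : X → ℂ} (hm : MemLp m ∞ μ) (f : Lp ℂ 2 μ) :
    mulOp hm f =ᵐ[μ] fun y => m y * f y := by
  filter_upwards [(ContinuousLinearMap.mul ℂ ℂ).coeFn_holder (r := 2) hm.toLp f, hm.coeFn_toLp]
    with y hmul hy
  rw [← hy]
  exact hmul

theorem mulOp_eq_zero {m : X → ℂ} (hm : MemLp m ∞ μ) {f : Lp ℂ 2 μ} {K : Set X}
    (hmK : ∀ y ∈ K, m y = 0) (hf : ∀ᵐ y ∂μ, y ∉ K → f y = 0) : mulOp hm f = 0 := by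
  refine Lp.ext ?_
  filter_upwards [coeFn_mulOp hm f, hf, Lp.coeFn_zero ℂ 2 μ] with y hy hfy h0
  rw [hy, h0, Pi.zero_apply, mul_eq_zero]
  exact (em (y ∈ K)).imp (hmK y) hfy

/-- `∑ᵢ |mᵢ(y)|² ≤ C²` for all `y`, so that `f ↦ (mᵢ f)ᵢ` is an operator of norm at most `C` from
`L²` to a Hilbert sum of copies of `L²`. -/
structure IsBoundedColumn (μ : Measure X) (m : ι → X → ℂ) (C : ℝ) : Prop where
  memLp : ∀ i, MemLp (m i) ∞ μ
  nonneg : 0 ≤ C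
  sum_sq_le : ∀ (s : Finset ι) (y : X), ∑ i ∈ s, ‖m i y‖ ^ 2 ≤ C ^ 2

/-- The operator `f ↦ (mᵢ f)ᵢ` of multiplication by a square-summable family of functions. -/
noncomputable def mulColumn {m : ι → X → ℂ} {C : ℝ} (h : IsBoundedColumn μ m C) :
    Lp ℂ 2 μ →L[ℂ] ℓ²(ι, Lp ℂ 2 μ) :=
  column (fun i => mulOp (h.memLp i)) C h.nonneg fun s f => by
    simp only [norm_sq_eq_integral]
    rw [mul_pow, norm_sq_eq_integral, ← integral_const_mul,
      ← integral_finsetSum _ fun i _ => integrable_norm_sq (mulOp (h.memLp i) f)]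
    refine integral_mono_ae (integrable_finsetSum _ fun i _ => integrable_norm_sq _)
      ((integrable_norm_sq f).const_mul _) ?_
    filter_upwards [(Finset.eventually_all s).2 fun i _ => coeFn_mulOp (h.memLp i) f] with y hy
    calc ∑ i ∈ s, ‖mulOp (h.memLp i) f y‖ ^ 2 = (∑ i ∈ s, ‖m i y‖ ^ 2) * ‖f y‖ ^ 2 := by
          rw [Finset.sum_mul]
          exact Finset.sum_congr rfl fun i hi => by rw [hy i hi, norm_mul, mul_pow]
      _ ≤ C ^ 2 * ‖f y‖ ^ 2 := mul_le_mul_of_nonneg_right (h.sum_sq_le s y) (sq_nonneg _)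

theorem mulColumn_apply {m : ι → X → ℂ} {C : ℝ} (h : IsBoundedColumn μ m C) (f : Lp ℂ 2 μ)
    (i : ι) : mulColumn h f i = mulOp (h.memLp i) f := rfl

theorem norm_mulColumn_le {m : ι → X → ℂ} {C : ℝ} (h : IsBoundedColumn μ m C) :
    ‖mulColumn h‖ ≤ C :=
  norm_column_le _ _ _ _

theorem exists_compactlySupported_eLpNorm_sub_le [TopologicalSpace X] [R1Space X] [BorelSpace X]
    (μ : Measure X) [μ.Regular] {f : X → ℂ} (hf : MemLp f 2 μ) {ε : ℝ≥0∞} (hε : ε ≠ 0) :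
    ∃ g : X → ℂ, eLpNorm (f - g) 2 μ ≤ ε ∧ MemLp g 2 μ ∧
      ∃ K : Set X, IsCompact K ∧ ∀ y ∉ K, g y = 0 := by
  refine hf.induction_dense ENNReal.ofNat_ne_top _ (fun c t ht htμ δ hδ => ?_) ?_
    (fun g hg => hg.1.aestronglyMeasurable) hε
  · obtain ⟨r, hr, hle⟩ := exists_eLpNorm_indicator_le (μ := μ) (p := 2) ENNReal.ofNat_ne_top c hδ
    obtain ⟨s, hst, hs, hsc, hμs⟩ :=
      ht.exists_isCompact_isClosed_sdiff_lt htμ.ne (ENNReal.coe_pos.2 hr).ne'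
    refine ⟨s.indicator fun _ => c, ?_, memLp_indicator_const 2 hsc.measurableSet c
      (Or.inr ((measure_mono hst).trans_lt htμ).ne), s, hs,
      fun y hy => Set.indicator_of_notMem hy _⟩
    rw [← eLpNorm_neg, neg_sub, ← Set.indicator_sdiff hst]
    exact hle _ hμs.le
  · rintro g h ⟨hg, K, hK, hgK⟩ ⟨hh, L, hL, hhL⟩
    refine ⟨hg.add hh, K ∪ L, hK.union hL, fun y hy => ?_⟩
    rw [Pi.add_apply, hgK y fun h => hy (.inl h), hhL y fun h => hy (.inr h), add_zero]

theorem dense_compactlySupported [TopologicalSpace X] [R1Space X] [BorelSpace X]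
    (μ : Measure X) [μ.Regular] :
    Dense {f : Lp ℂ 2 μ | ∃ K : Set X, IsCompact K ∧ ∀ᵐ y ∂μ, y ∉ K → f y = 0} := by
  refine fun f => EMetric.mem_closure_iff.2 fun ε hε => ?_
  obtain ⟨δ, hδ, hδε⟩ := exists_between hε
  obtain ⟨g, hfg, hg, K, hK, hgK⟩ :=
    exists_compactlySupported_eLpNorm_sub_le μ (Lp.memLp f) hδ.ne'
  refine ⟨hg.toLp, ⟨K, hK, ?_⟩, ?_⟩
  · filter_upwards [hg.coeFn_toLp] with y hy hyK
    rw [hy, hgK y hyK]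
  · rw [← Lp.toLp_coeFn f (Lp.memLp f), Lp.edist_toLp_toLp]
    exact hfg.trans_lt hδε

end Multiplication

/-! ### Sufficiency of a Gilbert representation -/

section Regular

variable {G : Type*} [Group G] [TopologicalSpace G] [IsTopologicalGroup G]
  [MeasurableSpace G] [BorelSpace G] (μ : Measure G) [μ.IsHaarMeasure]

theorem coeFn_leftRegular (x : G) (f : Lp ℂ 2 μ) :
    leftRegular μ x f =ᵐ[μ] fun y => f (x⁻¹ * y) :=
  Lp.coeFn_compMeasurePreserving f (measurePreserving_mul_left μ x⁻¹)

/-- The left regular representation as a homomorphism into the multiplicative monoid of bounded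
operators. -/
noncomputable def leftRegularHom : G →* (Lp ℂ 2 μ →L[ℂ] Lp ℂ 2 μ) where
  toFun := leftRegular μ
  map_one' := by
    ext1 f
    refine Lp.ext ?_
    filter_upwards [coeFn_leftRegular μ 1 f] with y hy
    rw [hy, inv_one, one_mul, one_apply_eq_self]
  map_mul' x y := by
    ext1 f
    refine Lp.ext ?_
    filter_upwards [coeFn_leftRegular μ (x * y) f, coeFn_leftRegular μ x (leftRegular μ y f),
      (measurePreserving_mul_left μ x⁻¹).quasiMeasurePreserving.ae (coeFn_leftRegular μ y f)]
      with z hxy hx hy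
    rw [hxy, mul_apply_eq_comp, hx, hy, mul_inv_rev, mul_assoc]

theorem leftRegular_one_apply (f : Lp ℂ 2 μ) : leftRegular μ 1 f = f :=
  DFunLike.congr_fun (map_one (leftRegularHom μ)) f

theorem leftRegular_leftRegular (x y : G) (f : Lp ℂ 2 μ) :
    leftRegular μ x (leftRegular μ y f) = leftRegular μ (x * y) f :=
  (DFunLike.congr_fun (map_mul (leftRegularHom μ) x y) f).symm

theorem norm_leftRegular_apply (x : G) (f : Lp ℂ 2 μ) : ‖leftRegular μ x f‖ = ‖f‖ :=
  LinearIsometry.norm_map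
    (Lp.compMeasurePreservingₗᵢ ℂ (x⁻¹ * ·) (measurePreserving_mul_left μ x⁻¹)) f

/-- The operator `λ(x)` as a unitary. -/
noncomputable def leftRegularEquiv (x : G) : Lp ℂ 2 μ ≃ₗᵢ[ℂ] Lp ℂ 2 μ where
  toFun := leftRegular μ x
  invFun := leftRegular μ x⁻¹
  map_add' := map_add _
  map_smul' := map_smul _
  left_inv f := by rw [leftRegular_leftRegular, inv_mul_cancel, leftRegular_one_apply]
  right_inv f := by rw [leftRegular_leftRegular, mul_inv_cancel, leftRegular_one_apply]
  norm_map' := norm_leftRegular_apply μ x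

theorem star_leftRegular (x : G) : star (leftRegular μ x) = leftRegular μ x⁻¹ :=
  (ContinuousLinearMap.star_eq_adjoint _).trans (leftRegularEquiv μ x).adjoint_eq_symm

theorem star_mem_mrange_leftRegularHom : ∀ s ∈ MonoidHom.mrange (leftRegularHom μ),
    star s ∈ MonoidHom.mrange (leftRegularHom μ) := by
  rintro _ ⟨x, rfl⟩
  exact ⟨x⁻¹, (star_leftRegular μ x).symm⟩

variable {μ} in
theorem Represents.unique {ω ω' : (groupVN μ).toStarSubalgebra →ₗ[ℂ] ℂ} {ψ : G → ℂ}
    (h : Represents μ ω ψ) (h' : Represents μ ω' ψ) : ω = ω' := by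
  refine InPredual.eq_of_eqOn (S := MonoidHom.mrange (leftRegularHom μ))
    (star_mem_mrange_leftRegularHom μ) h.1 h'.1 ?_
  rintro _ ⟨x, rfl⟩
  exact (h.2 x).symm.trans (h'.2 x)

theorem inner_ampl_mulColumn {ι : Type*} {φ : G → ℂ} {m n : ι → G → ℂ} {C D : ℝ}
    (hm : IsBoundedColumn μ m C) (hn : IsBoundedColumn μ n D)
    (hφ : ∀ x y, HasSum (fun i => conj (n i y) * m i (x⁻¹ * y)) (φ x)) (x : G) {K : Set G}
    {s : Set ι} (hs : s.Countable) (hms : ∀ i ∉ s, ∀ y ∈ K, m i y = 0) {f : Lp ℂ 2 μ}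
    (hf : ∀ᵐ y ∂μ, y ∉ K → f y = 0)
    (g : Lp ℂ 2 μ) :
    ⟪mulColumn hn g, ampl ι (leftRegular μ x) (mulColumn hm f)⟫_ℂ =
      φ x * ⟪g, leftRegular μ x f⟫_ℂ := by
  have hampl : ∀ i ∉ s, ampl ι (leftRegular μ x) (mulColumn hm f) i = 0 := fun i hi => by
    rw [ampl_apply, mulColumn_apply, mulOp_eq_zero _ (hms i hi) hf, map_zero]
  rw [inner_eq_integral_tsum hs hampl, L2.inner_def, ← integral_const_mul]
  have := hs.to_subtype
  have hinv := (measurePreserving_mul_left μ x⁻¹).quasiMeasurePreserving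
  refine integral_congr_ae ?_
  filter_upwards [ae_all_iff.2 fun i : s => coeFn_mulOp (hn.memLp i) g,
    hinv.ae (ae_all_iff.2 fun i : s => coeFn_mulOp (hm.memLp i) f),
    ae_all_iff.2 fun i : s => coeFn_leftRegular μ x (mulOp (hm.memLp i) f),
    hinv.ae hf, coeFn_leftRegular μ x f] with y hng hmf hxm hfK hxf
  have hterm : ∀ i : s, ⟪mulColumn hn g i y, ampl ι (leftRegular μ x) (mulColumn hm f) i y⟫_ℂ =
        conj (n i y) * m i (x⁻¹ * y) * (f (x⁻¹ * y) * conj (g y)) := fun i => by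
    rw [ampl_apply, mulColumn_apply, mulColumn_apply, hng, hxm, hmf, RCLike.inner_apply, map_mul]
    ring
  rw [tsum_congr hterm, tsum_mul_right, hxf, RCLike.inner_apply]
  by_cases hy : x⁻¹ * y ∈ K
  · have hsupp : (Function.support fun i => conj (n i y) * m i (x⁻¹ * y)) ⊆ s := fun i hi =>
        by_contra fun his => right_ne_zero_of_mul hi (hms i his _ hy)
    exact congrArg (· * _) ((hasSum_subtype_iff_of_support_subset hsupp).2 (hφ x y)).tsum_eq
  · simp only [hfK hy, zero_mul, mul_zero]

theorem compression_leftRegular [μ.Regular] {ι : Type*} {φ : G → ℂ} {m n : ι → G → ℂ} {C D : ℝ}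
    (hm : IsBoundedColumn μ m C) (hn : IsBoundedColumn μ n D)
    (hφ : ∀ x y, HasSum (fun i => conj (n i y) * m i (x⁻¹ * y)) (φ x))
    (hcount : ∀ K : Set G, IsCompact K → {i | ∃ y ∈ K, m i y ≠ 0}.Countable) (x : G) :
    compression (mulColumn hm) (mulColumn hn) (leftRegular μ x) = φ x • leftRegular μ x := by
  refine ContinuousLinearMap.ext <| congrFun <|
    Continuous.ext_on (dense_compactlySupported μ) (by fun_prop) (by fun_prop) ?_
  rintro f ⟨K, hK, hf⟩
  refine ext_inner_left ℂ fun g => ?_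
  rw [inner_compression, inner_ampl_mulColumn μ hm hn hφ x (hcount K hK)
    (fun i hi y hy => by_contra fun h => hi ⟨y, hy, h⟩) hf, smul_apply,
    inner_smul_right]

/-- `Φ(T) = W* (T ⊗ 1) V` is the transpose of multiplication by `φ`. -/
theorem isCBMultiplier_of_compression {ι : Type*} {φ : G → ℂ} (hφ : Continuous φ)
    (V W : Lp ℂ 2 μ →L[ℂ] ℓ²(ι, Lp ℂ 2 μ))
    (h : ∀ x, compression V W (leftRegular μ x) = φ x • leftRegular μ x) :
    IsCBMultiplier μ φ ∧ cbMultiplierNorm μ φ ≤ ENNReal.ofReal (‖W‖ * ‖V‖) := by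
  have hmem : ∀ T ∈ (groupVN μ).toStarSubalgebra,
      compression V W T ∈ (groupVN μ).toStarSubalgebra := fun T hT =>
    compression_mem (S := MonoidHom.mrange (leftRegularHom μ)) (star_mem_mrange_leftRegularHom μ)
      V W (by
        rintro _ ⟨x, rfl⟩
        exact (h x).symm ▸ SMulMemClass.smul_mem _ (mem_generatedVonNeumannAlgebra ⟨x, rfl⟩)) hT
  let Φ := restrictCompression (groupVN μ) V W hmem
  have hΦ : ∀ x, Φ (leftRegularVN μ x) = φ x • leftRegularVN μ x := fun x => Subtype.ext (h x)
  have hrep : ∀ ω ψ, Represents μ ω ψ → Represents μ (ω ∘ₗ Φ) (φ * ψ) := fun ω ψ hω =>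
    ⟨hω.1.comp_restrictCompression V W hmem, fun x => by
      rw [LinearMap.comp_apply, hΦ, map_smul, ← hω.2, smul_eq_mul, Pi.mul_apply]⟩
  have htranspose : IsTranspose μ φ Φ := fun ψ ω ω' hω hω' T =>
    DFunLike.congr_fun ((hrep ω ψ hω).unique hω') T
  have hcb := cbNorm_restrictCompression_le (groupVN μ) V W hmem
  refine ⟨⟨⟨hφ, ?_⟩, Φ, htranspose, hcb.trans_lt ENNReal.ofReal_lt_top⟩,
    (iInf₂_le Φ htranspose).trans hcb⟩
  rintro ψ ⟨ω, hω⟩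
  exact ⟨_, hrep ω ψ hω⟩

theorem LocallyCountable.countable_of_isCompact {X ι : Type*} [TopologicalSpace X]
    {f : ι → X → ℂ} (hf : LocallyCountable f) {K : Set X} (hK : IsCompact K) :
    {i | ∃ y ∈ K, f i y ≠ 0}.Countable := by
  refine hK.induction_on (p := fun K => {i | ∃ y ∈ K, f i y ≠ 0}.Countable) ?_
    (fun s t hst ht => ht.mono ?_) (fun s t hs ht => (hs.union ht).mono ?_) fun x _ => ?_
  · simp only [Set.mem_empty_iff_false, false_and, exists_false, Set.ofPred_false,
      Set.countable_empty]
  · rintro i ⟨y, hy, hne⟩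
    exact ⟨y, hst hy, hne⟩
  · rintro i ⟨y, hy | hy, hne⟩
    exacts [.inl ⟨y, hy, hne⟩, .inr ⟨y, hy, hne⟩]
  · obtain ⟨U, hU, hUc⟩ := hf x
    exact ⟨U, mem_nhdsWithin_of_mem_nhds hU, hUc⟩

variable {H : Type*} [NormedAddCommGroup H] [InnerProductSpace ℂ H] {ι : Type*}
  (e : HilbertBasis ι ℂ H)

omit [μ.IsHaarMeasure] in
theorem isBoundedColumn_inner_inv {ζ : G → H} (hζ : BddAbove (Set.range fun x => ‖ζ x‖))
    (hc : ∀ i, Continuous fun x => ⟪e i, ζ x⟫_ℂ) :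
    IsBoundedColumn μ (fun i y => ⟪e i, ζ y⁻¹⟫_ℂ) (⨆ x, ‖ζ x‖) where
  memLp i := memLp_top_of_bound ((hc i).comp continuous_inv).aestronglyMeasurable (⨆ x, ‖ζ x‖)
    (.of_forall fun y => (norm_inner_le_norm _ _).trans (by
      rw [e.orthonormal.1 i, one_mul]
      exact le_ciSup hζ y⁻¹))
  nonneg := Real.iSup_nonneg fun _ => norm_nonneg _
  sum_sq_le s y := (e.orthonormal.sum_inner_products_le (ζ y⁻¹)).trans
    (pow_le_pow_left₀ (norm_nonneg _) (le_ciSup hζ y⁻¹) 2)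

theorem IsGilbertPair.isCBMultiplier [μ.Regular] {φ : G → ℂ} (hφ : Continuous φ) {k : ℝ}
    {ξ η : G → H} (h : IsGilbertPair φ k ξ η) (hξ : HasGoodCoordinates e ξ)
    (hη : HasGoodCoordinates e η) :
    IsCBMultiplier μ φ ∧ cbMultiplierNorm μ φ ≤ ENNReal.ofReal k := by
  obtain ⟨hξb, hηb, hφξη, hk⟩ := h
  have hm := isBoundedColumn_inner_inv μ e hξb hξ.1
  have hn := isBoundedColumn_inner_inv μ e hηb hη.1
  have hsum : ∀ x y, HasSum (fun i => conj ⟪e i, η y⁻¹⟫_ℂ * ⟪e i, ξ (x⁻¹ * y)⁻¹⟫_ℂ) (φ x) :=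
    fun x y => by
      have := e.hasSum_inner_mul_inner (η y⁻¹) (ξ (x⁻¹ * y)⁻¹)
      rw [← hφξη, inv_inv, mul_inv_rev, inv_inv, mul_inv_cancel_left] at this
      simpa only [inner_conj_symm, mul_inv_rev, inv_inv] using this
  have hcount : ∀ K : Set G, IsCompact K → {i | ∃ y ∈ K, ⟪e i, ξ y⁻¹⟫_ℂ ≠ 0}.Countable :=
    fun K hK => (hξ.2.countable_of_isCompact hK.inv).mono <| by
      rintro i ⟨y, hy, hne⟩
      exact ⟨y⁻¹, Set.inv_mem_inv.2 hy, hne⟩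
  obtain ⟨hcb, hnorm⟩ := isCBMultiplier_of_compression μ hφ _ _
    (compression_leftRegular μ hm hn hsum hcount)
  refine ⟨hcb, hnorm.trans (ENNReal.ofReal_le_ofReal ?_)⟩
  calc ‖mulColumn hn‖ * ‖mulColumn hm‖ ≤ (⨆ y, ‖η y‖) * ⨆ x, ‖ξ x‖ :=
        mul_le_mul (norm_mulColumn_le hn) (norm_mulColumn_le hm)
          (ContinuousLinearMap.opNorm_nonneg _) hn.nonneg
    _ ≤ k := (mul_comm _ _).trans_le hk

end Regular

/-! ### Necessity of the Schur multiplier bound -/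

section ScalarMatrices

theorem norm_toEuclideanCLM_transpose {ι : Type*} [Fintype ι] [DecidableEq ι] (B : Matrix ι ι ℂ) :
    ‖Matrix.toEuclideanCLM (𝕜 := ℂ) Bᵀ‖ = ‖Matrix.toEuclideanCLM (𝕜 := ℂ) B‖ := by
  have hle : ∀ B : Matrix ι ι ℂ,
      ‖Matrix.toEuclideanCLM (𝕜 := ℂ) Bᵀ‖ ≤ ‖Matrix.toEuclideanCLM (𝕜 := ℂ) B‖ := fun B => by
    refine ContinuousLinearMap.opNorm_le_of_re_inner_le (norm_nonneg _) fun v u hv hu => ?_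
    have htranspose : v.ofLp ⬝ᵥ B *ᵥ star u.ofLp = star u.ofLp ⬝ᵥ Bᵀ *ᵥ v.ofLp := by
      rw [Matrix.mulVec_transpose, Matrix.dotProduct_mulVec, dotProduct_comm]
    have hinner : ‖v.ofLp ⬝ᵥ B *ᵥ star u.ofLp‖ =
        ‖⟪Matrix.toEuclideanCLM (𝕜 := ℂ) Bᵀ v, u⟫_ℂ‖ := by
      rw [htranspose, dotProduct_mulVec_eq_inner, star_star, norm_inner_symm]
    refine (RCLike.re_le_norm _).trans (hinner.symm.trans_le ?_)
    simpa only [norm_toLp_star, hu, hv, mul_one] using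
      norm_dotProduct_mulVec_le B v.ofLp (star u.ofLp)
  exact le_antisymm (hle B) (hle Bᵀ)

variable {H : Type*} [NormedAddCommGroup H] [InnerProductSpace ℂ H] {n : ℕ}

theorem norm_matrixOperator_conj (U : Fin n → H ≃ₗᵢ[ℂ] H)
    (a : Matrix (Fin n) (Fin n) (H →L[ℂ] H)) :
    ‖matrixOperator (Matrix.of fun i j =>
      ((U i).symm : H →L[ℂ] H) ∘L a i j ∘L (U j : H →L[ℂ] H))‖ = ‖matrixOperator a‖ := by
  let D := LinearIsometryEquiv.piLpCongrRight 2 U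
  have hcomp : matrixOperator (Matrix.of fun i j =>
      ((U i).symm : H →L[ℂ] H) ∘L a i j ∘L (U j : H →L[ℂ] H)) =
      (D.symm : _ →L[ℂ] _) ∘L matrixOperator a ∘L (D : _ →L[ℂ] _) := by
    ext v i
    rw [matrixOperator_apply]
    exact (map_sum (U i).symm (fun j => a i j (U j (v j))) Finset.univ).symm.trans
      (congrArg (U i).symm (matrixOperator_apply a (D v) i).symm)
  rw [hcomp, ContinuousLinearMap.opNorm_linearIsometryEquiv_comp,
    ContinuousLinearMap.opNorm_comp_linearIsometryEquiv]

theorem norm_toLp_smul (z : EuclideanSpace ℂ (Fin n)) (h : H) :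
    ‖WithLp.toLp 2 fun i => z i • h‖ = ‖z‖ * ‖h‖ := by
  simp only [PiLp.norm_eq_of_L2, norm_smul, mul_pow, ← Finset.sum_mul]
  rw [Real.sqrt_mul (by positivity), Real.sqrt_sq (norm_nonneg h)]

theorem matrixOperator_smul_one_toLp_smul (c : Matrix (Fin n) (Fin n) ℂ)
    (z : EuclideanSpace ℂ (Fin n)) (h : H) :
    matrixOperator (c.map (· • (1 : H →L[ℂ] H))) (WithLp.toLp 2 fun i => z i • h) =
      WithLp.toLp 2 fun i => Matrix.toEuclideanCLM (𝕜 := ℂ) c z i • h := by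
  ext i
  simp [matrixOperator_apply, Matrix.mulVec, dotProduct, Finset.sum_smul, smul_smul, mul_comm]

theorem matrixOperator_smul_one_complex (c : Matrix (Fin n) (Fin n) ℂ) :
    matrixOperator (c.map (· • (1 : ℂ →L[ℂ] ℂ))) = Matrix.toEuclideanCLM (𝕜 := ℂ) c := by
  ext v i
  exact matrixOperator_apply _ v i

theorem norm_toEuclideanCLM_le_norm_matrixOperator_smul_one [Nontrivial H]
    (c : Matrix (Fin n) (Fin n) ℂ) : ‖Matrix.toEuclideanCLM (𝕜 := ℂ) c‖ ≤
      ‖matrixOperator (c.map (· • (1 : H →L[ℂ] H)))‖ := by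
  obtain ⟨h, hh⟩ := exists_norm_eq H zero_le_one
  refine ContinuousLinearMap.opNorm_le_bound _ (ContinuousLinearMap.opNorm_nonneg _) fun z => ?_
  have := (matrixOperator (c.map (· • (1 : H →L[ℂ] H)))).le_opNorm (WithLp.toLp 2 fun i => z i • h)
  rwa [matrixOperator_smul_one_toLp_smul, norm_toLp_smul, norm_toLp_smul, hh, mul_one,
    mul_one] at this

variable [CompleteSpace H]

/-- An orthonormal basis identifies `c ⊗ 1` with a Hilbert sum of copies of `c`. -/
theorem norm_matrixOperator_smul_one_le (c : Matrix (Fin n) (Fin n) ℂ) :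
    ‖matrixOperator (c.map (· • (1 : H →L[ℂ] H)))‖ ≤ ‖Matrix.toEuclideanCLM (𝕜 := ℂ) c‖ := by
  obtain ⟨w, b, -⟩ := exists_hilbertBasis ℂ H
  let V : H →L[ℂ] ℓ²(w, ℂ) := b.repr.toLinearIsometry.toContinuousLinearMap
  have hV : ‖V‖ ≤ 1 := LinearIsometry.norm_toContinuousLinearMap_le _
  have hone : compression V V 1 = 1 := ContinuousLinearMap.ext fun f => ext_inner_left ℂ fun g =>
    (inner_compression V V 1 g f).trans (b.repr.inner_map_map g f)
  have hmap : (c.map (· • (1 : ℂ →L[ℂ] ℂ))).map (compression V V) =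
      c.map (· • (1 : H →L[ℂ] H)) := by
    ext1 i j
    simp only [Matrix.map_apply, map_smul, hone]
  calc ‖matrixOperator (c.map (· • (1 : H →L[ℂ] H)))‖
      ≤ ‖V‖ * ‖Matrix.toEuclideanCLM (𝕜 := ℂ) c‖ * ‖V‖ := by
        rw [← hmap, ← matrixOperator_smul_one_complex]
        exact norm_matrixOperator_compression_le V V _
    _ ≤ 1 * ‖Matrix.toEuclideanCLM (𝕜 := ℂ) c‖ * 1 := by gcongr
    _ = ‖Matrix.toEuclideanCLM (𝕜 := ℂ) c‖ := by rw [one_mul, mul_one]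

theorem norm_matrixOperator_smul_one [Nontrivial H] (c : Matrix (Fin n) (Fin n) ℂ) :
    ‖matrixOperator (c.map (· • (1 : H →L[ℂ] H)))‖ = ‖Matrix.toEuclideanCLM (𝕜 := ℂ) c‖ :=
  (norm_matrixOperator_smul_one_le c).antisymm
    (norm_toEuclideanCLM_le_norm_matrixOperator_smul_one c)

end ScalarMatrices

theorem nontrivial_Lp_two {X : Type*} [TopologicalSpace X] [MeasurableSpace X]
    [OpensMeasurableSpace X] [Nonempty X] (μ : Measure X) [IsLocallyFiniteMeasure μ]
    [μ.IsOpenPosMeasure] : Nontrivial (Lp ℂ 2 μ) := by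
  obtain ⟨x⟩ := ‹Nonempty X›
  obtain ⟨U, hxU, hU, hμU⟩ := μ.exists_isOpen_measure_lt_top x
  refine ⟨indicatorConstLp 2 hU.measurableSet hμU.ne 1, 0, fun h => ?_⟩
  have hnorm := congrArg norm h
  rw [norm_indicatorConstLp two_ne_zero ENNReal.ofNat_ne_top, norm_zero, norm_one, one_mul] at hnorm
  have hpos : 0 < μ.real U := ENNReal.toReal_pos (hU.measure_pos μ ⟨x, hxU⟩).ne' hμU.ne
  exact (Real.rpow_pos_of_pos hpos _).ne' hnorm

section VectorFunctional

variable {H : Type*} [NormedAddCommGroup H] [InnerProductSpace ℂ H] [CompleteSpace H]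

/-- The vector functional `T ↦ ⟨T f, g⟩` on a von Neumann algebra. -/
noncomputable def vectorFunctional (M : VonNeumannAlgebra H) (f g : H) :
    M.toStarSubalgebra →ₗ[ℂ] ℂ where
  toFun T := ⟪g, (T : H →L[ℂ] H) f⟫_ℂ
  map_add' S T := inner_add_right g ((S : H →L[ℂ] H) f) ((T : H →L[ℂ] H) f)
  map_smul' c T := inner_smul_right g ((T : H →L[ℂ] H) f) c

theorem inPredual_vectorFunctional (M : VonNeumannAlgebra H) (f g : H) :
    InPredual M (vectorFunctional M f g) :=
  inPredual_of_lp (lp.single 2 (0 : ℕ) f) (lp.single 2 (0 : ℕ) g) fun T => by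
    rw [ampl_single, lp.inner_single_left, lp.single_apply_self]
    rfl

end VectorFunctional

section Necessity

variable {G : Type*} [Group G] [TopologicalSpace G] [IsTopologicalGroup G]
  [MeasurableSpace G] [BorelSpace G] {μ : Measure G} [μ.IsHaarMeasure]

theorem IsTranspose.apply_leftRegularVN {φ : G → ℂ} (hφ : IsMultiplier μ φ)
    {Φ : (groupVN μ).toStarSubalgebra →ₗ[ℂ] (groupVN μ).toStarSubalgebra}
    (hΦ : IsTranspose μ φ Φ) (x : G) : Φ (leftRegularVN μ x) = φ x • leftRegularVN μ x := by
  refine Subtype.ext (ContinuousLinearMap.ext fun f => ext_inner_left ℂ fun g => ?_)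
  let ω := vectorFunctional (groupVN μ) f g
  have hω : Represents μ ω fun x => ω (leftRegularVN μ x) :=
    ⟨inPredual_vectorFunctional (groupVN μ) f g, fun _ => rfl⟩
  obtain ⟨ω', hω'⟩ := hφ.2 _ ⟨ω, hω⟩
  calc ω (Φ (leftRegularVN μ x)) = ω' (leftRegularVN μ x) := hΦ _ ω ω' hω hω' _
    _ = φ x • ω (leftRegularVN μ x) := (hω'.2 x).symm
    _ = ω (φ x • leftRegularVN μ x) := (map_smul ω _ _).symm

variable [LocallyCompactSpace G]

theorem norm_matrixOperator_smul_leftRegular {n : ℕ} (c : Matrix (Fin n) (Fin n) ℂ)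
    (x : Fin n → G) :
    ‖matrixOperator (Matrix.of fun i j => c i j • leftRegular μ ((x i)⁻¹ * x j))‖ =
      ‖Matrix.toEuclideanCLM (𝕜 := ℂ) c‖ := by
  have := nontrivial_Lp_two μ
  rw [← norm_matrixOperator_smul_one (H := Lp ℂ 2 μ),
    ← norm_matrixOperator_conj (fun i => leftRegularEquiv μ (x i)) (c.map _)]
  congr 2
  ext1 i j
  ext1 f
  exact (congrArg (c i j • ·) (leftRegular_leftRegular μ (x i)⁻¹ (x j) f).symm).trans
    (map_smul (leftRegular μ (x i)⁻¹) (c i j) (leftRegular μ (x j) f)).symm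

/-- The transpose is tested on the matrices `[b j i • λ(x i⁻¹ x j)]`. -/
theorem schurNorm_le_cbNorm {φ : G → ℂ}
    {Φ : (groupVN μ).toStarSubalgebra →ₗ[ℂ] (groupVN μ).toStarSubalgebra}
    (hΦ : ∀ x, Φ (leftRegularVN μ x) = φ x • leftRegularVN μ x) {n : ℕ} (x : Fin n → G) :
    schurNorm (Matrix.of fun i j => φ ((x j)⁻¹ * x i)) ≤ cbNorm (groupVN μ) Φ := by
  refine iSup₂_le fun b hb => ?_
  let a : Matrix (Fin n) (Fin n) ℂ := Matrix.of fun i j => φ ((x j)⁻¹ * x i)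
  let A : Matrix (Fin n) (Fin n) (groupVN μ).toStarSubalgebra :=
    Matrix.of fun i j => bᵀ i j • leftRegularVN μ ((x i)⁻¹ * x j)
  have hA : ‖matrixOperator (A.map fun T => (T : Lp ℂ 2 μ →L[ℂ] Lp ℂ 2 μ))‖ ≤ 1 :=
    (norm_matrixOperator_smul_leftRegular bᵀ x).trans_le
      ((norm_toEuclideanCLM_transpose b).trans_le hb)
  have hΦA : (A.map fun T => (Φ T : Lp ℂ 2 μ →L[ℂ] Lp ℂ 2 μ)) =
      Matrix.of fun i j => (a.hadamard b)ᵀ i j • leftRegular μ ((x i)⁻¹ * x j) := by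
    ext1 i j
    have : Φ (A i j) = (a.hadamard b)ᵀ i j • leftRegularVN μ ((x i)⁻¹ * x j) := by
      simp only [A, a, Matrix.of_apply, map_smul, hΦ, Matrix.transpose_apply,
        Matrix.hadamard_apply, smul_smul, mul_comm (b j i)]
    exact congrArg Subtype.val this
  have hnorm : ‖Matrix.toEuclideanCLM (𝕜 := ℂ) (a.hadamard b)‖ₑ =
      ‖matrixOperator (A.map fun T => (Φ T : Lp ℂ 2 μ →L[ℂ] Lp ℂ 2 μ))‖ₑ := by
    rw [← ofReal_norm, ← ofReal_norm, hΦA, norm_matrixOperator_smul_leftRegular,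
      norm_toEuclideanCLM_transpose]
  exact hnorm.trans_le (le_iSup_of_le n (le_iSup₂_of_le A hA le_rfl))

theorem IsCBMultiplier.schurNorm_le {φ : G → ℂ} (hφ : IsCBMultiplier μ φ) {n : ℕ}
    (x : Fin n → G) :
    schurNorm (Matrix.of fun i j => φ ((x j)⁻¹ * x i)) ≤ cbMultiplierNorm μ φ :=
  le_iInf₂ fun _ hΦ => schurNorm_le_cbNorm (hΦ.apply_leftRegularVN hφ.1) x

end Necessity

end HerzSchur

theorem theorem3p2_general {G : Type u} [Group G] [TopologicalSpace G] [IsTopologicalGroup G]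
    [LocallyCompactSpace G] [MeasurableSpace G] [BorelSpace G]
    (μ : Measure G) [μ.IsHaarMeasure] [μ.Regular]
    (φ : G → ℂ) (hφ : Continuous φ) (k : ℝ) (hk : 0 ≤ k) :
    List.TFAE [
      HerzSchur.IsCBMultiplier μ φ ∧ HerzSchur.cbMultiplierNorm μ φ ≤ ENNReal.ofReal k,
      ∀ (n : ℕ) (x : Fin n → G), Function.Injective x →
        HerzSchur.schurNorm (Matrix.of fun i j => φ ((x j)⁻¹ * x i)) ≤ ENNReal.ofReal k,
      ∃ (H : Type (max u v)) (_ : NormedAddCommGroup H) (_ : InnerProductSpace ℂ H)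
        (_ : CompleteSpace H) (ξ η : G → H), HerzSchur.IsGilbertPair φ k ξ η,
      ∃ (H : Type (max u v)) (_ : NormedAddCommGroup H) (_ : InnerProductSpace ℂ H)
        (_ : CompleteSpace H) (ξ η : G → H), HerzSchur.IsGilbertPair φ k ξ η ∧
          ∀ (ι : Type (max u v)) (e : HilbertBasis ι ℂ H),
            HerzSchur.HasGoodCoordinates e ξ ∧ HerzSchur.HasGoodCoordinates e η] := by
  tfae_have 1 → 2 := fun ⟨h, hle⟩ n x _ => (h.schurNorm_le x).trans hle
  tfae_have 2 → 3 := fun h => HerzSchur.exists_isGilbertPair_of_schurNorm_le.{u, v} hk h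
  tfae_have 3 → 4 := fun ⟨_, _, _, _, _, _, h⟩ => h.exists_hasGoodCoordinates μ hφ
  tfae_have 4 → 1 := by
    rintro ⟨H, _, _, _, ξ, η, h, hgood⟩
    obtain ⟨w, e, -⟩ := exists_hilbertBasis ℂ H
    exact h.isCBMultiplier μ e hφ (hgood w e).1 (hgood w e).2
  tfae_finish

theorem theorem3p2 {G : Type u} [Group G] [TopologicalSpace G] [IsTopologicalGroup G]
    [LocallyCompactSpace G] [T2Space G] [MeasurableSpace G] [BorelSpace G]
    (μ : Measure G) [μ.IsHaarMeasure] [μ.Regular]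
    (φ : G → ℂ) (hφ : Continuous φ) (k : ℝ) (hk : 0 ≤ k) :
    List.TFAE [
      HerzSchur.IsCBMultiplier μ φ ∧ HerzSchur.cbMultiplierNorm μ φ ≤ ENNReal.ofReal k,
      ∀ (n : ℕ) (x : Fin n → G), Function.Injective x →
        HerzSchur.schurNorm (Matrix.of fun i j => φ ((x j)⁻¹ * x i)) ≤ ENNReal.ofReal k,
      ∃ (H : Type (max u v)) (_ : NormedAddCommGroup H) (_ : InnerProductSpace ℂ H)
        (_ : CompleteSpace H) (ξ η : G → H), HerzSchur.IsGilbertPair φ k ξ η,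
      ∃ (H : Type (max u v)) (_ : NormedAddCommGroup H) (_ : InnerProductSpace ℂ H)
        (_ : CompleteSpace H) (ξ η : G → H), HerzSchur.IsGilbertPair φ k ξ η ∧
          ∀ (ι : Type (max u v)) (e : HilbertBasis ι ℂ H),
            HerzSchur.HasGoodCoordinates e ξ ∧ HerzSchur.HasGoodCoordinates e η] :=
  theorem3p2_general.{u, v} μ φ hφ k hk
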